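/- **Definitions.** Let $B$ be a Boolean algebra with $0\neq 1$. A *partition* of $b\in B$ is a set of pairwise disjoint non-zero elements with join $b$. A *zero-dimensional topology* $\mathcal J$ on $B$ is a set of partitions of $1$ that contains all finite ones, that contains $\{b\wedge c: b\in P,\ c\in Q_b\}\setminus\{0\}$ whenever $P\in\mathcal J$ and $Q_b\in\mathcal J$ for all $b\in P$, and such that for $P\in\mathcal J$ and every surjection $\alpha\colon P\to I$ the joins $\bigvee\alpha^{-1}(i)$ exist and form a member of $\mathcal J$. Write $\mathcal J_b$ for the set of those $P$ with join $b$ that are contained in a member of $\mathcal J$. A *$B_{\mathcal J}$-set* is a set $X$ with operations $(x,y)\mapsto b(x,y)$ for $b\in B$ such that $b(x,x)=x$, $b(b(x,y),z)=b(x,z)=b(x,b(y,z))$, $1(x,y)=x$, $b'(x,y)=b(y,x)$, $(b\wedge c)(x,y)=b(c(x,y),y)$, and with operations $P\colon X^P\to X$ for infinite $P\in\mathcal J$ such that $P(\lambda b.x)=x$, $P(\lambda b.\,b(x_b,y_b))=P(\lambda b.\,x_b)$ and $b(P(x),x_b)=x_b$ for $b\in P$. Write $x\equiv_b y$ for $b(x,y)=y$.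 A *Grothendieck matched pair of algebras* $\langle B_{\mathcal J}|M\rangle$ consists of such $B$ and $\mathcal J$, a monoid $M$ that is also a $B_{\mathcal J}$-set, and a left action $(m,b)\mapsto m^*b$ of $M$ on $B$ by Boolean homomorphisms with $\{m^*b:b\in P\}\setminus\{0\}\in\mathcal J$ for $P\in\mathcal J$, such that $b(m,n)p=b(mp,np)$, $m\,b(n,p)=(m^*b)(mn,mp)$ and $b(m,n)^*c=(b\wedge m^*c)\vee(b'\wedge n^*c)$. An *$\langle B_{\mathcal J}|M\rangle$-set* is a $B_{\mathcal J}$-set $X$ with a left $M$-action such that $b(m,n)\cdot x=b(m\cdot x,n\cdot x)$ and $m\cdot b(x,y)=(m^*b)(m\cdot x,m\cdot y)$; with the maps preserving all operations these form the category $\langle B_{\mathcal J}|M\rangle\text{-}\mathbf{Set}$. An *$\langle B_{\mathcal J}|M\rangle$-presheaf* is a family of sets $X(b)$ $(b\in B\setminus\{0\})$ with functions $m\cdot(-)\colon X(c)\to X(m^*c)$ (when $m^*c\ne0$) and $b\wedge(-)\colon X(c)\to X(b\wedge c)$ (when $b\wedge c\neq 0$) satisfying, whenever defined, for $x\in X(c)$: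 $c\wedge x=x$, $(a\wedge b)\wedge x=a\wedge(b\wedge x)$, $1\cdot x=x$, $(mn)\cdot x=m\cdot(n\cdot x)$, $m\cdot(b\wedge x)=(m^*b)\wedge(m\cdot x)$, and $b\wedge(m\cdot x)=b\wedge(n\cdot x)$ if $m\equiv_b n$. It is a *sheaf* if for all $c\ne0$ and $P\in\mathcal J_c$ there is an operation $P\colon\prod_{b\in P}X(b)\to X(c)$ with $b\wedge P(x)=x_b$ for $b\in P$ and $P(\lambda b.\,b\wedge x)=x$ for $x\in X(c)$. Sheaves and the families of functions preserving all $m\cdot(-)$ and $b\wedge(-)$ form the category $\langle B_{\mathcal J}|M\rangle\text{-}\mathbf{Shv}$. The functor $B\wedge(-)\colon\langle B_{\mathcal J}|M\rangle\text{-}\mathbf{Set}\to\langle B_{\mathcal J}|M\rangle\text{-}\mathbf{Shv}$ sends $X$ to the sheaf with $(B\wedge X)(b)=X/{\equiv_b}$, whose elements are written $b\wedge x$, with $b\wedge(c\wedge x)=(b\wedge c)\wedge x$ and $m\cdot(c\wedge x)=(m^*c)\wedge(m\cdot x)$, and sends $f$ to $b\wedge x\mapsto b\wedge f(x)$. A *topos*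 is a cartesian closed category with pullbacks and a subobject classifier. A cartesian closed category is *two-valued* if each of its objects $X$ either is initial or has $X\to 1$ epimorphic. An ideal $I\subseteq B$ is *$\mathcal J$-closed* if $b\in I$ whenever some $P\in\mathcal J_b$ has $P\subseteq I$. The *classifying localic category* has the frame $\mathrm{Idl}_{\mathcal J}(B)$ of $\mathcal J$-closed ideals as locale of objects; its locale of arrows is the frame, ordered pointwise, of the functions $f\colon M\to\mathrm{Idl}_{\mathcal J}(B)$ such that $m\equiv_b n$ implies $f(m)\cap{\downarrow}b=f(n)\cap{\downarrow}b$; its source and target maps are $s^*(I)=\lambda m.\,I$ and $t^*(I)=\lambda m.\,m^*I$, with $m^*I$ the $\mathcal J$-closed ideal generated by $\{m^*b:b\in I\}$. It is *minimal* if $0$ and $1$ are the only elements $u$ of the frame of objects with $t^*(u)\le s^*(u)$. If every member of $\mathcal J$ is finite, the *classifying topological category* has the Stone space of ultrafilters $\mathcal U$ of $B$ as space of objects; its arrows are the pairs $(\mathcal U,m)$ with $m$ taken modulo $m\equiv_{\mathcal U}n\iff\exists b\in\mathcal U,\ m\equiv_b n$, topologised by the basic open sets $\{(\mathcal U,m):b\in\mathcal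 U\}$ for $b\in B$, $m\in M$; $(\mathcal U,m)$ has source $\mathcal U$ and target $m_!\mathcal U=\{b:m^*b\in\mathcal U\}$; the identities are $(\mathcal U,1)$ and the composite of $(\mathcal U,m)$ followed by $(m_!\mathcal U,n)$ is $(\mathcal U,mn)$. It is *minimal* if $\emptyset$ and the whole space are the only open sets of objects that contain the source of every arrow whose target they contain. **Theorem 8.** Let $\langle B_{\mathcal J}|M\rangle$ be a Grothendieck matched pair of algebras. The following are equivalent: (i) for all $b\in B\setminus\{0\}$ there exists $m\in M$ with $m^*b=1$; (ii) the topos $\langle B_{\mathcal J}|M\rangle\text{-}\mathbf{Shv}$ is two-valued; (iii) $B\wedge(-)\colon\langle B_{\mathcal J}|M\rangle\text{-}\mathbf{Set}\to\langle B_{\mathcal J}|M\rangle\text{-}\mathbf{Shv}$ is an equivalence of categories; (iv) $\langle B_{\mathcal J}|M\rangle\text{-}\mathbf{Set}$ is a topos; (v) the classifying localic category of $\langle B_{\mathcal J}|M\rangle$ is minimal. If moreover every member of $\mathcal J$ is finite, then these conditions are also equivalent to minimality of the classifying topological category. -/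

import Mathlib

open CategoryTheory CategoryTheory.Limits

universe u v

set_option linter.unusedSectionVars false

/-! ## Zero-dimensional topologies on Boolean algebras -/

section Topologies

variable {B : Type u} [BooleanAlgebra B]

/-- A partition of `b`: a set of pairwise disjoint non-zero elements with join `b`. -/
structure IsPartition (P : Set B) (b : B) : Prop where
  bot_notMem : ⊥ ∉ P
  isLUB : IsLUB P b
  disjoint : ∀ c ∈ P, ∀ d ∈ P, c ≠ d → c ⊓ d = ⊥

variable (B) in
/-- A zero-dimensional topology on a Boolean algebra `B`. -/
structure ZeroDimTopology where
  /-- the distinguished partitions (of the top element) -/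
  parts : Set (Set B)
  isPartition : ∀ P ∈ parts, IsPartition P ⊤
  finite_mem : ∀ P : Set B, IsPartition P ⊤ → P.Finite → P ∈ parts
  refine_mem : ∀ P ∈ parts, ∀ Q : B → Set B, (∀ b ∈ P, Q b ∈ parts) →
    {a | ∃ b ∈ P, ∃ c ∈ Q b, a = b ⊓ c} \ {⊥} ∈ parts
  collapse_mem : ∀ P ∈ parts, ∀ (I : Type u) (α : P → I), Function.Surjective α →
    ∃ j : I → B, (∀ i, IsLUB {b | ∃ h : b ∈ P, α ⟨b, h⟩ = i} (j i)) ∧ Set.range j ∈ parts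

namespace ZeroDimTopology

variable (J : ZeroDimTopology B)

/-- The distinguished partitions of an arbitrary element `b`. -/
def covers (b : B) : Set (Set B) := {P | ∃ Q ∈ J.parts, P ⊆ Q ∧ IsLUB P b}

variable {J}

theorem inf_eq_of_mem_covers {P : Set B} {b c : B} (hP : P ∈ J.covers c) (hb : b ∈ P) :
    b ⊓ c = b := by
  obtain ⟨Q, _, _, hl⟩ := hP
  exact inf_eq_left.2 (hl.1 hb)

theorem inf_mem_covers {P : Set B} {b y : B} (hP : P ∈ J.covers b) (hy : y ≤ b) :
    ((fun p => y ⊓ p) '' P) \ {⊥} ∈ J.covers y := by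
  classical
  obtain ⟨Q, hQ, hPQ, hl⟩ := hP
  have hfin : ({y, yᶜ} \ {⊥} : Set B) ∈ J.parts := by
    refine J.finite_mem _ ⟨by simp, ⟨fun _ _ => le_top, ?_⟩, ?_⟩ ((Set.toFinite _).subset
      Set.sdiff_subset)
    · intro z hz
      have h1 : y ≤ z := by
        by_cases h : y = ⊥
        · simp [h]
        · exact hz ⟨by simp, h⟩
      have h2 : yᶜ ≤ z := by
        by_cases h : yᶜ = ⊥
        · rw [h]; exact bot_le
        · exact hz ⟨by simp, h⟩
      rw [← sup_compl_eq_top (x := y)]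
      exact sup_le h1 h2
    · rintro c ⟨hc, -⟩ d ⟨hd, -⟩ hne
      simp only [Set.mem_insert_iff, Set.mem_singleton_iff] at hc hd
      rcases hc with rfl | rfl <;> rcases hd with rfl | rfl <;> simp_all
  refine ⟨_, J.refine_mem _ hfin (fun _ => Q) (fun _ _ => hQ), ?_, ?_, ?_⟩
  · rintro _ ⟨⟨p, hp, rfl⟩, hne⟩
    refine ⟨⟨y, ⟨by simp, ?_⟩, p, hPQ hp, rfl⟩, hne⟩
    rintro (rfl : y = ⊥)
    exact hne (by simp)
  · rintro _ ⟨⟨p, hp, rfl⟩, -⟩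
    exact inf_le_left
  · intro z hz
    have : b ≤ y ⇨ z := by
      refine hl.2 fun p hp => ?_
      rw [le_himp_iff, inf_comm]
      by_cases h : y ⊓ p = ⊥
      · rw [h]; exact bot_le
      · exact hz ⟨⟨p, hp, rfl⟩, h⟩
    rw [le_himp_iff, inf_eq_right.2 hy] at this
    exact this

end ZeroDimTopology

end Topologies

/-! ## Actions of (Grothendieck) Boolean algebras on sets -/

/-- A `B`-set; `cond b x y` is "if `b` then `x` else `y`". -/
class BSet (B : Type u) [BooleanAlgebra B] (X : Type v) where
  cond : B → X → X → X
  cond_self : ∀ b x, cond b x x = x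
  cond_cond_left : ∀ b x y z, cond b (cond b x y) z = cond b x z
  cond_cond_right : ∀ b x y z, cond b x (cond b y z) = cond b x z
  cond_top : ∀ x y, cond ⊤ x y = x
  cond_compl : ∀ b x y, cond bᶜ x y = cond b y x
  cond_inf : ∀ b c x y, cond (b ⊓ c) x y = cond b (cond c x y) y

/-- The structure that a `B`-set needs in order to be a `B_J`-set: an operation of arity `P` for
every infinite partition `P` in the topology. -/
class BJSet {B : Type u} [BooleanAlgebra B] (J : ZeroDimTopology B) (X : Type v) [BSet B X] where
  glue : ∀ P ∈ J.parts, P.Infinite → (P → X) → X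
  glue_const : ∀ (P : Set B) (hP : P ∈ J.parts) (hi : P.Infinite) (x : X), glue P hP hi (fun _ => x) = x
  glue_cond : ∀ (P : Set B) (hP : P ∈ J.parts) (hi : P.Infinite) (x y : P → X),
    glue P hP hi (fun b => BSet.cond b.1 (x b) (y b)) = glue P hP hi x
  cond_glue : ∀ (P : Set B) (hP : P ∈ J.parts) (hi : P.Infinite) (x : P → X) (b : P), BSet.cond b.1 (glue P hP hi x) (x b) = x b

namespace BSet

variable {B : Type u} [BooleanAlgebra B] {X : Type v} [BSet B X]

/-- The relation `x ≡_b y`: "if `b` then `x = y`". -/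
def EqOn (b : B) (x y : X) : Prop := cond b x y = y

theorem EqOn.refl (b : B) (x : X) : EqOn b x x := cond_self b x

theorem EqOn.symm {b : B} {x y : X} (h : EqOn b x y) : EqOn b y x := by
  unfold EqOn at *
  rw [← h, cond_cond_left, cond_self]

theorem EqOn.trans {b : B} {x y z : X} (h : EqOn b x y) (h' : EqOn b y z) : EqOn b x z := by
  unfold EqOn at *
  rw [← h, cond_cond_left] at h'
  exact h'

theorem EqOn.mono {b c : B} {x y : X} (h : EqOn b x y) (hc : c ≤ b) : EqOn c x y := by
  unfold EqOn at *
  rw [← inf_eq_left.2 hc, cond_inf, h, cond_self]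

theorem EqOn.sup {b c : B} {x y : X} (h : EqOn b x y) (h' : EqOn c x y) : EqOn (b ⊔ c) x y := by
  unfold EqOn at *
  have : b ⊔ c = (bᶜ ⊓ cᶜ)ᶜ := by simp
  rw [this, cond_compl, cond_inf, cond_compl, cond_compl, h', h]

theorem eqOn_bot (x y : X) : EqOn (⊥ : B) x y := by
  unfold EqOn
  rw [← compl_top, cond_compl, cond_top]

theorem eqOn_top {x y : X} (h : EqOn (⊤ : B) x y) : x = y := by
  unfold EqOn at h
  rwa [cond_top] at h

theorem cond_eqOn (b : B) (x y : X) : EqOn b (cond b x y) x := by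
  unfold EqOn
  rw [cond_cond_left, cond_self]

theorem cond_eqOn_compl (b : B) (x y : X) : EqOn bᶜ (cond b x y) y := by
  unfold EqOn
  rw [cond_compl, cond_cond_right, cond_self]

variable (X) in
/-- The relation `≡_b` as a setoid. -/
def setoid (b : B) : Setoid X := ⟨EqOn b, EqOn.refl b, EqOn.symm, EqOn.trans⟩

end BSet

namespace BJSet

open BSet

variable {B : Type u} [BooleanAlgebra B] {J : ZeroDimTopology B} {X : Type v} [BSet B X]

theorem eqOn_finset_sup (s : Finset B) {x y : X} (h : ∀ b ∈ s, EqOn b x y) :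
    EqOn (s.sup id) x y := by
  classical
  induction s using Finset.induction_on with
  | empty => exact eqOn_bot x y
  | insert a s _ ih =>
    rw [Finset.sup_insert]
    exact (h a (by simp)).sup (ih fun b hb => h b (by simp [hb]))

variable [BJSet J X]

theorem eq_of_eqOn {P : Set B} (hP : P ∈ J.parts) {x y : X} (h : ∀ b ∈ P, EqOn b x y) :
    x = y := by
  by_cases hf : P.Finite
  · apply eqOn_top (B := B)
    refine (eqOn_finset_sup hf.toFinset (x := x) (y := y) fun b hb => h b (by simpa using hb)).mono ?_
    refine (J.isPartition P hP).isLUB.2 fun b hb => ?_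
    exact Finset.le_sup (f := id) (hf.mem_toFinset.2 hb)
  · have hi : P.Infinite := hf
    rw [← glue_const P hP hi x, ← glue_const P hP hi y,
      ← glue_cond P hP hi (fun _ => x) (fun _ => y)]
    congr 1
    funext b
    exact h b.1 b.2

theorem exists_eqOn {P : Set B} (hP : P ∈ J.parts) [Nonempty X] (x : B → X) :
    ∃ z : X, ∀ b ∈ P, EqOn b z (x b) := by
  classical
  by_cases hf : P.Finite
  · have key : ∀ s : Finset B, (∀ b ∈ s, b ∈ P) → ∃ z : X, ∀ b ∈ s, EqOn b z (x b) := by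
      intro s
      induction s using Finset.induction_on with
      | empty => exact fun _ => ⟨Classical.arbitrary X, by simp⟩
      | insert a s ha ih =>
        intro hs
        obtain ⟨z, hz⟩ := ih fun b hb => hs b (by simp [hb])
        refine ⟨cond a (x a) z, fun b hb => ?_⟩
        rcases Finset.mem_insert.1 hb with rfl | hb'
        · exact cond_eqOn _ _ _
        · have hne : b ≠ a := by rintro rfl; exact ha hb'
          have hd := (J.isPartition P hP).disjoint b (hs b hb) a (hs a (by simp)) hne
          exact ((cond_eqOn_compl a (x a) z).mono
            (disjoint_iff.2 hd).le_compl_right).trans (hz b hb')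
    obtain ⟨z, hz⟩ := key hf.toFinset (by simp)
    exact ⟨z, fun b hb => hz b (by simpa using hb)⟩
  · exact ⟨glue P hP hf fun b => x b.1, fun b hb => cond_glue P hP hf _ ⟨b, hb⟩⟩

theorem eqOn_of_covers {P : Set B} {b : B} (hP : P ∈ J.covers b) {x y : X}
    (h : ∀ c ∈ P, EqOn c x y) : EqOn b x y := by
  obtain ⟨Q, hQ, hPQ, hl⟩ := hP
  refine eq_of_eqOn hQ fun c hc => ?_
  by_cases hcP : c ∈ P
  · exact ((cond_eqOn b x y).mono (hl.1 hcP)).trans (h c hcP)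
  · refine (cond_eqOn_compl b x y).mono ?_
    have : b ≤ cᶜ := hl.2 fun p hp => by
      refine (disjoint_iff.2 ((J.isPartition Q hQ).disjoint p (hPQ hp) c hc ?_)).le_compl_right
      rintro rfl
      exact hcP hp
    exact le_compl_comm.1 this

end BJSet

/-! ## Grothendieck matched pairs and their sets -/

/-- A Grothendieck matched pair of algebras: a Grothendieck Boolean algebra `B_J`, a monoid `M`
with `B_J`-set structure, and an action of `M` on `B` (with `m • b` standing for `m^* b`) by
Grothendieck Boolean homomorphisms, subject to three compatibility axioms. -/
class MatchedPair {B : Type u} [BooleanAlgebra B] (J : ZeroDimTopology B) (M : Type v) [Monoid M]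
    [MulAction M B] [BSet B M] [BJSet J M] : Prop where
  smul_bot : ∀ m : M, m • (⊥ : B) = ⊥
  smul_top : ∀ m : M, m • (⊤ : B) = ⊤
  smul_inf : ∀ (m : M) (b c : B), m • (b ⊓ c) = m • b ⊓ m • c
  smul_sup : ∀ (m : M) (b c : B), m • (b ⊔ c) = m • b ⊔ m • c
  smul_mem : ∀ (m : M), ∀ P ∈ J.parts, ((fun b => m • b) '' P) \ {⊥} ∈ J.parts
  cond_mul : ∀ (b : B) (m n p : M), BSet.cond b m n * p = BSet.cond b (m * p) (n * p)
  mul_cond : ∀ (b : B) (m n p : M), m * BSet.cond b n p = BSet.cond (m • b) (m * n) (m * p)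
  cond_smul : ∀ (b : B) (m n : M) (c : B),
    BSet.cond b m n • c = (b ⊓ m • c) ⊔ (bᶜ ⊓ n • c)

section MatchedPairs

open BSet

namespace MatchedPair

variable {B : Type u} [BooleanAlgebra B] {M : Type v} [Monoid M] [MulAction M B] [BSet B M]

theorem inf_smul_eq (J : ZeroDimTopology B) [BJSet J M] [MatchedPair J M]
    {b : B} {m n : M} (h : EqOn b m n) (c : B) : b ⊓ m • c = b ⊓ n • c := by
  have h1 := cond_smul (J := J) b m n c
  rw [h] at h1
  rw [h1, inf_sup_left, ← inf_assoc, ← inf_assoc]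
  simp

theorem smul_mono (J : ZeroDimTopology B) [BJSet J M] [MatchedPair J M]
    (m : M) {b c : B} (h : b ≤ c) : m • b ≤ m • c := by
  rw [← inf_eq_left.2 h, smul_inf (J := J)]
  exact inf_le_right

theorem smul_compl (J : ZeroDimTopology B) [BJSet J M] [MatchedPair J M]
    (m : M) (b : B) : m • bᶜ = (m • b)ᶜ := by
  symm
  apply IsCompl.compl_eq
  constructor
  · rw [disjoint_iff, ← smul_inf (J := J), inf_compl_eq_bot, smul_bot (J := J)]
  · rw [codisjoint_iff, ← smul_sup (J := J), sup_compl_eq_top, smul_top (J := J)]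

theorem mul_eqOn (J : ZeroDimTopology B) [BJSet J M] [MatchedPair J M]
    {b : B} {m n : M} (h : EqOn b m n) (p : M) : EqOn b (m * p) (n * p) := by
  unfold EqOn at *
  rw [← cond_mul (J := J), h]

theorem eqOn_mul (J : ZeroDimTopology B) [BJSet J M] [MatchedPair J M]
    (m : M) {b : B} {n p : M} (h : EqOn b n p) : EqOn (m • b) (m * n) (m * p) := by
  unfold EqOn at *
  rw [← mul_cond (J := J), h]

theorem smul_mem_covers {J : ZeroDimTopology B} [BJSet J M] [MatchedPair J M] (m : M) {P : Set B} {b : B} (hP : P ∈ J.covers b) :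
    ((fun b => m • b) '' P) \ {⊥} ∈ J.covers (m • b) := by
  obtain ⟨Q, hQ, hPQ, hl⟩ := hP
  refine ⟨_, smul_mem m Q hQ, Set.sdiff_subset_sdiff_left (Set.image_mono hPQ), ?_, ?_⟩
  · rintro _ ⟨⟨p, hp, rfl⟩, -⟩
    exact smul_mono J m (hl.1 hp)
  · intro z hz
    have : (⊤ : B) ≤ m • b ⇨ z := by
      refine (J.isPartition _ (smul_mem m Q hQ)).isLUB.2 ?_
      rintro _ ⟨⟨q, hq, rfl⟩, hne⟩
      rw [le_himp_iff]
      by_cases hqP : q ∈ P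
      · exact inf_le_left.trans (hz ⟨⟨q, hqP, rfl⟩, hne⟩)
      · have hb : b ≤ qᶜ := hl.2 fun p hp => by
          refine (disjoint_iff.2
            ((J.isPartition Q hQ).disjoint p (hPQ hp) q hq ?_)).le_compl_right
          rintro rfl
          exact hqP hp
        have h0 : q ⊓ b = ⊥ := disjoint_iff.1 (le_compl_iff_disjoint_left.1 hb)
        change m • q ⊓ m • b ≤ z
        rw [← smul_inf (J := J), h0, smul_bot (J := J)]
        exact bot_le
    simpa [le_himp_iff] using this

end MatchedPair

variable {B : Type u} [BooleanAlgebra B] (J : ZeroDimTopology B) (M : Type u) [Monoid M]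
  [MulAction M B] [BSet B M] [BJSet J M]

/-- A `⟨B_J|M⟩`-set (in the universe of `B` and `M`). -/
structure BMSet where
  carrier : Type u
  [bset : BSet B carrier]
  [bjset : BJSet J carrier]
  [act : MulAction M carrier]
  cond_smul : ∀ (b : B) (m n : M) (x : carrier), BSet.cond b m n • x = BSet.cond b (m • x) (n • x)
  smul_cond : ∀ (m : M) (b : B) (x y : carrier),
    m • BSet.cond b x y = BSet.cond (m • b) (m • x) (m • y)

namespace BMSet

attribute [instance] BMSet.bset BMSet.bjset BMSet.act

variable {J M}

/-- Homomorphisms of `⟨B_J|M⟩`-sets preserve all the operations. -/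
@[ext]
structure Hom (X Y : BMSet J M) where
  toFun : X.carrier → Y.carrier
  map_cond : ∀ (b : B) x y, toFun (BSet.cond b x y) = BSet.cond b (toFun x) (toFun y)
  map_glue : ∀ (P : Set B) (hP : P ∈ J.parts) (hi : P.Infinite) (x : P → X.carrier),
    toFun (BJSet.glue (J := J) P hP hi x) = BJSet.glue (J := J) P hP hi (fun b => toFun (x b))
  map_smul : ∀ (m : M) x, toFun (m • x) = m • toFun x

/-- The category of `⟨B_J|M⟩`-sets. -/
instance : Category (BMSet J M) where
  Hom := Hom
  id X := ⟨id, fun _ _ _ => rfl, fun _ _ _ _ => rfl, fun _ _ => rfl⟩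
  comp f g := ⟨g.toFun ∘ f.toFun, fun b x y => by simp [f.map_cond, g.map_cond],
    fun P hP hi x => by simp [f.map_glue, g.map_glue], fun m x => by simp [f.map_smul, g.map_smul]⟩

@[simp] theorem id_toFun (X : BMSet J M) : Hom.toFun (𝟙 X) = id := rfl

@[simp] theorem comp_toFun {X Y Z : BMSet J M} (f : X ⟶ Y) (g : Y ⟶ Z) :
    Hom.toFun (f ≫ g) = Hom.toFun g ∘ Hom.toFun f := rfl

@[ext] theorem hom_ext {X Y : BMSet J M} {f g : X ⟶ Y} (h : Hom.toFun f = Hom.toFun g) : f = g :=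
  Hom.ext h

theorem Hom.map_eqOn {X Y : BMSet J M} (f : Hom X Y) {b : B} {x y : X.carrier}
    (h : EqOn b x y) : EqOn b (f.toFun x) (f.toFun y) := by
  unfold EqOn at *
  rw [← f.map_cond, h]

theorem smul_eqOn {X : BMSet J M} {b : B} {m n : M} (h : EqOn b m n) (x : X.carrier) :
    EqOn b (m • x) (n • x) := by
  unfold EqOn at *
  rw [← X.cond_smul, h]

theorem eqOn_smul {X : BMSet J M} (m : M) {b : B} {x y : X.carrier} (h : EqOn b x y) :
    EqOn (m • b) (m • x) (m • y) := by
  unfold EqOn at *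
  rw [← X.smul_cond, h]

end BMSet

/-! ## Sheaves on a Grothendieck matched pair -/

/-- The non-zero elements of `B`. -/
abbrev NonBot (B : Type u) [BooleanAlgebra B] : Type u := {b : B // b ≠ ⊥}

/-- A `⟨B_J|M⟩`-presheaf. The operations `m · (-) : X(c) → X(m^* c)` and
`b ∧ (-) : X(c) → X(b ∧ c)` are indexed by an element `d` together with a proof that `d` is
`m^* c`, respectively `b ∧ c`. -/
structure BMPresheaf (B : Type u) [BooleanAlgebra B] (M : Type u) [Monoid M] [MulAction M B]
    [BSet B M] where
  sec : NonBot B → Type u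
  act : ∀ (m : M) {c d : NonBot B}, m • c.1 = d.1 → sec c → sec d
  meet : ∀ (b : B) {c d : NonBot B}, b ⊓ c.1 = d.1 → sec c → sec d
  meet_self : ∀ {c : NonBot B} (h : c.1 ⊓ c.1 = c.1) (x : sec c), meet c.1 h x = x
  meet_meet : ∀ (a b : B) {c d e : NonBot B} (h : b ⊓ c.1 = d.1) (h' : a ⊓ d.1 = e.1)
    (h'' : (a ⊓ b) ⊓ c.1 = e.1) (x : sec c), meet (a ⊓ b) h'' x = meet a h' (meet b h x)
  one_act : ∀ {c : NonBot B} (h : (1 : M) • c.1 = c.1) (x : sec c), act 1 h x = x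
  mul_act : ∀ (m n : M) {c d e : NonBot B} (h : n • c.1 = d.1) (h' : m • d.1 = e.1)
    (h'' : (m * n) • c.1 = e.1) (x : sec c), act (m * n) h'' x = act m h' (act n h x)
  act_meet : ∀ (m : M) (b : B) {c d e f : NonBot B} (h : b ⊓ c.1 = d.1) (h' : m • d.1 = e.1)
    (k : m • c.1 = f.1) (k' : m • b ⊓ f.1 = e.1) (x : sec c),
    act m h' (meet b h x) = meet (m • b) k' (act m k x)
  meet_act_of_eqOn : ∀ (b : B) (m n : M), EqOn b m n → ∀ {c d d' e : NonBot B} (h : m • c.1 = d.1)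
    (h' : n • c.1 = d'.1) (k : b ⊓ d.1 = e.1) (k' : b ⊓ d'.1 = e.1) (x : sec c),
    meet b k (act m h x) = meet b k' (act n h' x)

namespace BMPresheaf

variable {M}

/-- Homomorphisms of presheaves. -/
@[ext]
structure Hom (X Y : BMPresheaf B M) where
  app : ∀ c : NonBot B, X.sec c → Y.sec c
  map_act : ∀ (m : M) {c d : NonBot B} (h : m • c.1 = d.1) (x : X.sec c),
    app d (X.act m h x) = Y.act m h (app c x)
  map_meet : ∀ (b : B) {c d : NonBot B} (h : b ⊓ c.1 = d.1) (x : X.sec c),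
    app d (X.meet b h x) = Y.meet b h (app c x)

/-- The category of `⟨B_J|M⟩`-presheaves. -/
instance : Category (BMPresheaf B M) where
  Hom := Hom
  id X := ⟨fun _ => id, fun _ _ _ _ _ => rfl, fun _ _ _ _ _ => rfl⟩
  comp f g := ⟨fun c => g.app c ∘ f.app c, fun m _ _ h x => by simp [f.map_act, g.map_act],
    fun b _ _ h x => by simp [f.map_meet, g.map_meet]⟩

@[simp] theorem id_app (X : BMPresheaf B M) (c) : Hom.app (𝟙 X) c = id := rfl

@[simp] theorem comp_app {X Y Z : BMPresheaf B M} (f : X ⟶ Y) (g : Y ⟶ Z) (c) :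
    Hom.app (f ≫ g) c = Hom.app g c ∘ Hom.app f c := rfl

@[ext] theorem hom_ext {X Y : BMPresheaf B M} {f g : X ⟶ Y}
    (h : ∀ c, Hom.app f c = Hom.app g c) : f = g :=
  Hom.ext (funext h)

variable (M) in
/-- The sheaf condition: for each `P ∈ J_c` there is an operation that glues families indexed by
`P` (it is unique, by the two equations). -/
def IsSheaf : ObjectProperty (BMPresheaf B M) := fun X =>
  ∀ (c : NonBot B) (P : Set B) (hP : P ∈ J.covers c.1),
    ∃ glue : (∀ b : NonBot B, b.1 ∈ P → X.sec b) → X.sec c,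
      (∀ x b (hb : b.1 ∈ P),
        X.meet b.1 (ZeroDimTopology.inf_eq_of_mem_covers hP hb) (glue x) = x b hb) ∧
      ∀ x : X.sec c,
        glue (fun b hb => X.meet b.1 (ZeroDimTopology.inf_eq_of_mem_covers hP hb) x) = x

end BMPresheaf

/-- The category of `⟨B_J|M⟩`-sheaves. -/
abbrev BMShv := (BMPresheaf.IsSheaf J M).FullSubcategory

/-- The terminal sheaf. -/
def BMShv.one : BMShv J M where
  obj :=
    { sec := fun _ => PUnit
      act := fun _ _ _ _ _ => PUnit.unit
      meet := fun _ _ _ _ _ => PUnit.unit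
      meet_self := by intros; rfl
      meet_meet := by intros; rfl
      one_act := by intros; rfl
      mul_act := by intros; rfl
      act_meet := by intros; rfl
      meet_act_of_eqOn := by intros; rfl }
  property := fun _ _ _ => ⟨fun _ => PUnit.unit, fun _ _ _ => rfl, fun _ => rfl⟩

instance : HasTerminal (BMShv J M) :=
  (IsTerminal.ofUniqueHom (Y := BMShv.one J M)
    (fun X => ObjectProperty.homMk
      ⟨fun _ _ => PUnit.unit, fun _ _ _ _ _ => rfl, fun _ _ _ _ _ => rfl⟩)
    (fun X f => by
      apply ObjectProperty.hom_ext
      apply BMPresheaf.hom_ext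
      intro c
      funext x
      rfl)).hasTerminal

/-! ## The functor `B ∧ (-)` -/

variable [MatchedPair J M]

variable {J M} in
/-- The presheaf `B ∧ X`, with `(B ∧ X)(b) = X / ≡_b`. -/
def wedgePresheaf (X : BMSet J M) : BMPresheaf B M where
  sec b := Quotient (BSet.setoid X.carrier b.1)
  act m _ _ h := Quotient.map (fun x => m • x) fun _ _ hxy => h ▸ BMSet.eqOn_smul m hxy
  meet b _ _ h := Quotient.map id fun _ _ hxy => BSet.EqOn.mono hxy (h ▸ inf_le_right)
  meet_self := by
    rintro c h ⟨x⟩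
    rfl
  meet_meet := by
    rintro a b c d e h h' h'' ⟨x⟩
    rfl
  one_act := by
    rintro c h ⟨x⟩
    exact congrArg (Quotient.mk _) (one_smul M x)
  mul_act := by
    rintro m n c d e h h' h'' ⟨x⟩
    exact congrArg (Quotient.mk _) (mul_smul m n x)
  act_meet := by
    rintro m b c d e f h h' k k' ⟨x⟩
    rfl
  meet_act_of_eqOn := by
    rintro b m n hmn c d d' e h h' k k' ⟨x⟩
    exact Quotient.sound ((BMSet.smul_eqOn hmn x).mono (k ▸ inf_le_left))

variable {J M} in
theorem wedgePresheaf_isSheaf (X : BMSet J M) :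
    BMPresheaf.IsSheaf J M (wedgePresheaf X) := by
  classical
  intro c P hP
  have key : ∀ x : (∀ b : NonBot B, b.1 ∈ P → (wedgePresheaf X).sec b),
      ∃ z : (wedgePresheaf X).sec c, ∀ b (hb : b.1 ∈ P),
        (wedgePresheaf X).meet b.1 (ZeroDimTopology.inf_eq_of_mem_covers hP hb) z = x b hb := by
    intro x
    obtain ⟨Q, hQ, hPQ, hl⟩ := hP
    have hne : P.Nonempty := by
      by_contra h
      rw [Set.not_nonempty_iff_eq_empty] at h
      subst h
      exact c.2 (isLUB_empty_iff.1 hl).eq_bot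
    have h0 : ∀ b ∈ P, b ≠ ⊥ := by
      rintro b hb rfl
      exact (J.isPartition Q hQ).bot_notMem (hPQ hb)
    obtain ⟨p, hp⟩ := hne
    let u : X.carrier := (x ⟨p, h0 p hp⟩ hp).out
    have : Nonempty X.carrier := ⟨u⟩
    obtain ⟨z, hz⟩ := BJSet.exists_eqOn hQ
      (fun b => if h : b ∈ P then (x ⟨b, h0 b h⟩ h).out else u)
    refine ⟨Quotient.mk _ z, fun b hb => ?_⟩
    have hz' := hz b.1 (hPQ hb)
    rw [dif_pos hb] at hz'
    exact (Quotient.sound hz').trans (Quotient.out_eq (x b hb))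
  have uniq : ∀ z z' : (wedgePresheaf X).sec c, (∀ b : NonBot B, ∀ hb : b.1 ∈ P,
        (wedgePresheaf X).meet b.1 (ZeroDimTopology.inf_eq_of_mem_covers hP hb) z =
        (wedgePresheaf X).meet b.1 (ZeroDimTopology.inf_eq_of_mem_covers hP hb) z') →
        z = z' := by
    rintro ⟨z⟩ ⟨z'⟩ h
    refine Quotient.sound (BJSet.eqOn_of_covers hP fun b hb => ?_)
    have hb0 : b ≠ ⊥ := by
      obtain ⟨Q, hQ, hPQ, hl⟩ := hP
      rintro rfl
      exact (J.isPartition Q hQ).bot_notMem (hPQ hb)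
    exact Quotient.exact (h ⟨b, hb0⟩ hb)
  choose g hg using key
  exact ⟨g, hg, fun x => uniq _ _ fun b hb => hg _ b hb⟩

/-- The functor `B ∧ (-)` from `⟨B_J|M⟩`-sets to `⟨B_J|M⟩`-sheaves. -/
def wedge : BMSet J M ⥤ BMShv J M where
  obj X := ⟨wedgePresheaf X, wedgePresheaf_isSheaf X⟩
  map f := ObjectProperty.homMk
    { app := fun _ => Quotient.map (BMSet.Hom.toFun f) fun _ _ h => BMSet.Hom.map_eqOn f h
      map_act := by
        rintro m c d h ⟨x⟩
        exact congrArg (Quotient.mk _) (BMSet.Hom.map_smul f m x)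
      map_meet := by
        rintro b c d h ⟨x⟩
        rfl }
  map_id X := by
    apply ObjectProperty.hom_ext
    apply BMPresheaf.hom_ext
    intro c
    funext x
    induction x using Quotient.inductionOn with | h x => rfl
  map_comp f g := by
    apply ObjectProperty.hom_ext
    apply BMPresheaf.hom_ext
    intro c
    funext x
    induction x using Quotient.inductionOn with | h x => rfl

end MatchedPairs

/-! ## Toposes -/

section Toposes

variable (C : Type u) [Category.{v} C]

/-- A topos: a cartesian closed category with pullbacks and a subobject classifier. -/
def IsTopos : Prop :=
  (∃ _ : CartesianMonoidalCategory C, Nonempty (MonoidalClosed C)) ∧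
    HasPullbacks C ∧ HasSubobjectClassifier C

/-- The objects of the two-valued collapse: those that are initial or well-supported. -/
def twoValuedCollapse [HasTerminal C] : ObjectProperty C := fun X =>
  Nonempty (IsInitial X) ∨ Epi (terminal.from X)

/-- A category is two-valued if it equals its two-valued collapse. -/
def IsTwoValued [HasTerminal C] : Prop := twoValuedCollapse C = ⊤

end Toposes

/-! ## The classifying localic category -/

section Localic

/-- The part of a localic category that the notion of open sieve refers to: the locales of objects
and of arrows, given by their frames of opens, and the source and target maps, given by their
inverse image homomorphisms. -/
structure LocalicGraph where
  Ob : Type u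
  Arr : Type u
  [frameOb : Order.Frame Ob]
  [frameArr : Order.Frame Arr]
  src : FrameHom Ob Arr
  tgt : FrameHom Ob Arr

attribute [instance] LocalicGraph.frameOb LocalicGraph.frameArr

/-- Open sieves: opens `U` of the locale of objects with `t^* U ≤ s^* U`. -/
def LocalicGraph.IsOpenSieve (G : LocalicGraph.{u}) (U : G.Ob) : Prop := G.tgt U ≤ G.src U

/-- Minimality: the only open sieves are the least and the greatest open. -/
def LocalicGraph.IsMinimal (G : LocalicGraph.{u}) : Prop :=
  ∀ U : G.Ob, G.IsOpenSieve U → U = ⊥ ∨ U = ⊤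

variable {B : Type u} [BooleanAlgebra B] (J : ZeroDimTopology B)

/-- The `J`-closed ideals of `B`. -/
structure JIdeal where
  toIdeal : Order.Ideal B
  closed : ∀ (b : B), ∀ P ∈ J.covers b, (∀ c ∈ P, c ∈ toIdeal) → b ∈ toIdeal

namespace JIdeal

variable {J}

instance : SetLike (JIdeal J) B where
  coe I := I.toIdeal
  coe_injective := by
    rintro ⟨I, _⟩ ⟨K, _⟩ h
    congr
    exact SetLike.coe_injective h

/-- `J`-closed ideals are ordered by inclusion. -/
instance : PartialOrder (JIdeal J) := .ofSetLike (JIdeal J) B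

theorem le_def {I K : JIdeal J} : I ≤ K ↔ ∀ b ∈ I, b ∈ K := Iff.rfl

theorem lower (I : JIdeal J) {b c : B} (h : c ≤ b) (hb : b ∈ I) : c ∈ I :=
  I.toIdeal.lower h hb

theorem sup_mem (I : JIdeal J) {b c : B} (hb : b ∈ I) (hc : c ∈ I) : b ⊔ c ∈ I :=
  Order.Ideal.sup_mem hb hc

theorem bot_mem (I : JIdeal J) : ⊥ ∈ I := Order.Ideal.bot_mem I.toIdeal

theorem mem_of_covers (I : JIdeal J) {b : B} {P : Set B} (hP : P ∈ J.covers b)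
    (h : ∀ c ∈ P, c ∈ I) : b ∈ I := I.closed b P hP h

/-- Constructor from a set. -/
def ofSet (S : Set B) (hlow : ∀ b c, c ≤ b → b ∈ S → c ∈ S) (hbot : ⊥ ∈ S)
    (hsup : ∀ b c, b ∈ S → c ∈ S → b ⊔ c ∈ S)
    (hcl : ∀ b, ∀ P ∈ J.covers b, (∀ c ∈ P, c ∈ S) → b ∈ S) : JIdeal J where
  toIdeal :=
    { carrier := S
      lower' := fun b c h hb => hlow b c h hb
      nonempty' := ⟨⊥, hbot⟩
      directed' := fun b hb c hc => ⟨b ⊔ c, hsup b c hb hc, le_sup_left, le_sup_right⟩ }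
  closed := hcl

@[simp] theorem mem_ofSet {S : Set B} {h1 h2 h3 h4} {b : B} :
    b ∈ (ofSet S h1 h2 h3 h4 : JIdeal J) ↔ b ∈ S := Iff.rfl

instance : InfSet (JIdeal J) where
  sInf S := ofSet {b | ∀ I ∈ S, b ∈ I} (fun _ _ h hb I hI => I.lower h (hb I hI))
    (fun I _ => I.bot_mem) (fun _ _ hb hc I hI => I.sup_mem (hb I hI) (hc I hI))
    (fun _ _ hP h I hI => I.mem_of_covers hP fun c hc => h c hc I hI)

theorem mem_sInf {S : Set (JIdeal J)} {b : B} : b ∈ sInf S ↔ ∀ I ∈ S, b ∈ I := Iff.rfl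

instance : CompleteLattice (JIdeal J) :=
  { completeLatticeOfInf (JIdeal J) fun S =>
      ⟨fun I hI b hb => hb I hI, fun K hK b hb I hI => hK hI hb⟩ with
    inf := fun I K => ofSet {b | b ∈ I ∧ b ∈ K} (fun _ _ h hb => ⟨I.lower h hb.1, K.lower h hb.2⟩)
      ⟨I.bot_mem, K.bot_mem⟩ (fun _ _ hb hc => ⟨I.sup_mem hb.1 hc.1, K.sup_mem hb.2 hc.2⟩)
      (fun _ _ hP h => ⟨I.mem_of_covers hP fun c hc => (h c hc).1,
        K.mem_of_covers hP fun c hc => (h c hc).2⟩)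
    inf_le_left := fun _ _ _ hb => hb.1
    inf_le_right := fun _ _ _ hb => hb.2
    le_inf := fun _ _ _ h h' b hb => ⟨h hb, h' hb⟩
    top := ofSet Set.univ (by simp) (by simp) (by simp) (by simp)
    le_top := fun _ _ _ => trivial }

theorem mem_inf {I K : JIdeal J} {b : B} : b ∈ I ⊓ K ↔ b ∈ I ∧ b ∈ K := Iff.rfl

theorem mem_top {b : B} : b ∈ (⊤ : JIdeal J) := trivial

/-- `J`-closed ideals form a frame. -/
instance : Order.Frame (JIdeal J) := .ofMinimalAxioms
  { inf_sSup_le_iSup_inf := by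
      intro I S
      set L : JIdeal J := ⨆ K ∈ S, I ⊓ K with hL
      let N : JIdeal J := ofSet {x | ∀ y ≤ x, y ∈ I → y ∈ L}
        (fun b c h hb y hy => hb y (hy.trans h))
        (fun y hy _ => L.lower hy L.bot_mem)
        (fun b c hb hc y hy hyI => by
          have : y = (y ⊓ b) ⊔ (y ⊓ c) := by
            rw [← inf_sup_left, inf_eq_left.2 hy]
          rw [this]
          exact L.sup_mem (hb _ inf_le_right (I.lower inf_le_left hyI))
            (hc _ inf_le_right (I.lower inf_le_left hyI)))
        (fun b P hP h y hy hyI => by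
          refine L.mem_of_covers (ZeroDimTopology.inf_mem_covers hP hy) ?_
          rintro _ ⟨⟨p, hp, rfl⟩, -⟩
          exact h p hp _ inf_le_right (I.lower inf_le_left hyI))
      have hN : sSup S ≤ N := by
        refine sSup_le fun K hK x hx y hy hyI => ?_
        have : I ⊓ K ≤ L := le_iSup₂_of_le K hK le_rfl
        exact this ⟨hyI, K.lower hy hx⟩
      intro y hy
      exact hN hy.2 y le_rfl hy.1 }

/-- The principal ideal of the elements below `b`. -/
def principal (J : ZeroDimTopology B) (b : B) : JIdeal J :=
  ofSet {c | c ≤ b} (fun _ _ h h' => h.trans h') bot_le (fun _ _ => sup_le)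
    (fun _ _ hP h => by
      obtain ⟨_, _, _, hl⟩ := hP
      exact hl.2 h)

theorem mem_principal {b c : B} : c ∈ principal J b ↔ c ≤ b := Iff.rfl

variable {M : Type u} [Monoid M] [MulAction M B] [BSet B M] [BJSet J M]

/-- `m^* I`: the `J`-closed ideal generated by the elements `m^* b` for `b ∈ I`. -/
def pull (m : M) (I : JIdeal J) : JIdeal J := sInf {K | ∀ b ∈ I, m • b ∈ K}

variable [MatchedPair J M]

theorem smul_mem_pull (m : M) {I : JIdeal J} {b : B} (hb : b ∈ I) : m • b ∈ pull m I :=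
  mem_sInf.2 fun _ hK => hK b hb

theorem pull_le {m : M} {I K : JIdeal J} : pull m I ≤ K ↔ ∀ b ∈ I, m • b ∈ K :=
  ⟨fun h _ hb => h (smul_mem_pull m hb), fun h => sInf_le h⟩

/-- The right adjoint of `pull m`. -/
def push (m : M) (K : JIdeal J) : JIdeal J :=
  ofSet {b | m • b ∈ K} (fun _ _ h hb => K.lower (MatchedPair.smul_mono J m h) hb)
    (by
      change m • (⊥ : B) ∈ K
      rw [MatchedPair.smul_bot (J := J)]
      exact K.bot_mem)
    (fun b c hb hc => by
      change m • (b ⊔ c) ∈ K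
      rw [MatchedPair.smul_sup (J := J)]
      exact K.sup_mem hb hc)
    (fun b P hP h => K.mem_of_covers (MatchedPair.smul_mem_covers m hP) (by
      rintro _ ⟨⟨p, hp, rfl⟩, -⟩
      exact h p hp))

theorem gc_pull_push (m : M) : GaloisConnection (pull (J := J) m) (push m) :=
  fun _ _ => pull_le

theorem pull_top (m : M) : pull m (⊤ : JIdeal J) = ⊤ := by
  refine top_le_iff.1 fun b _ => (pull m ⊤).lower le_top ?_
  rw [← MatchedPair.smul_top (J := J) m]
  exact smul_mem_pull m mem_top

theorem pull_inf (m : M) (I K : JIdeal J) : pull m (I ⊓ K) = pull m I ⊓ pull m K := by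
  refine le_antisymm ((gc_pull_push m).monotone_l.map_inf_le I K) ?_
  rw [← le_himp_iff, pull_le]
  intro b hb
  suffices h : pull m K ≤ principal J (m • b) ⇨ pull m (I ⊓ K) by
    rw [le_himp_iff, inf_comm, ← le_himp_iff] at h
    exact h (mem_principal.2 le_rfl)
  rw [pull_le]
  intro c hc
  suffices h : principal J (m • c) ≤ principal J (m • b) ⇨ pull m (I ⊓ K) from
    h (mem_principal.2 le_rfl)
  rw [le_himp_iff]
  intro x hx
  refine (pull m (I ⊓ K)).lower (c := x) (b := m • (b ⊓ c)) ?_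
    (smul_mem_pull m ⟨I.lower inf_le_left hb, K.lower inf_le_right hc⟩)
  rw [MatchedPair.smul_inf (J := J)]
  exact le_inf hx.2 hx.1

theorem pull_sSup (m : M) (S : Set (JIdeal J)) :
    pull m (sSup S) = sSup (pull m '' S) := by
  rw [(gc_pull_push m).l_sSup, sSup_image]

theorem pull_inf_principal_le {m n : M} {b : B} (h : BSet.EqOn b m n) (I : JIdeal J) :
    pull m I ⊓ principal J b ≤ pull n I := by
  rw [← le_himp_iff, pull_le]
  intro c hc
  suffices h' : principal J (m • c) ≤ principal J b ⇨ pull n I from h' (mem_principal.2 le_rfl)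
  rw [le_himp_iff]
  intro x hx
  refine (pull n I).lower (b := n • c) ?_ (smul_mem_pull n hc)
  have : x ≤ b ⊓ m • c := le_inf hx.2 hx.1
  rw [MatchedPair.inf_smul_eq J h] at this
  exact this.trans inf_le_right

end JIdeal

variable (M : Type u) [Monoid M] [MulAction M B] [BSet B M] [BJSet J M]

/-- The `B_J`-set homomorphisms from `M` to the `J`-closed ideals, that is, the functions that
preserve each `≡_b`, where `I ≡_b K` means that `I` and `K` have the same elements below `b`. -/
@[ext]
structure ClassifyingArr : Type u where
  val : M → JIdeal J
  property : ∀ (b : B) (m n : M), BSet.EqOn b m n →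
    val m ⊓ JIdeal.principal J b = val n ⊓ JIdeal.principal J b

namespace ClassifyingArr

variable {J M}

/-- The order is pointwise. -/
instance : PartialOrder (ClassifyingArr J M) :=
  PartialOrder.lift ClassifyingArr.val fun _ _ => ClassifyingArr.ext

theorem le_def {f g : ClassifyingArr J M} : f ≤ g ↔ ∀ m, f.val m ≤ g.val m := Iff.rfl

instance : SupSet (ClassifyingArr J M) where
  sSup S := ⟨fun m => ⨆ f ∈ S, f.val m, fun b m n h => by
    simp only [iSup_inf_eq]
    exact iSup_congr fun f => iSup_congr fun _ => f.property b m n h⟩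

theorem sSup_apply (S : Set (ClassifyingArr J M)) (m : M) : (sSup S).val m = ⨆ f ∈ S, f.val m := rfl

instance : CompleteLattice (ClassifyingArr J M) :=
  { completeLatticeOfSup (ClassifyingArr J M) fun S =>
      ⟨fun f hf m => le_iSup₂_of_le f hf le_rfl,
        fun _ hg m => iSup₂_le fun _ hf => hg hf m⟩ with
    inf := fun f g => ⟨fun m => f.val m ⊓ g.val m, fun b m n h => by
      rw [inf_inf_distrib_right, f.property b m n h, g.property b m n h, ← inf_inf_distrib_right]⟩
    inf_le_left := fun _ _ _ => inf_le_left
    inf_le_right := fun _ _ _ => inf_le_right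
    le_inf := fun _ _ _ h h' m => le_inf (h m) (h' m)
    top := ⟨fun _ => ⊤, fun _ _ _ _ => rfl⟩
    le_top := fun _ _ => le_top }

theorem inf_apply (f g : ClassifyingArr J M) (m : M) : (f ⊓ g).val m = f.val m ⊓ g.val m := rfl

/-- With the pointwise order, these homomorphisms form a frame. -/
instance : Order.Frame (ClassifyingArr J M) := .ofMinimalAxioms
  { inf_sSup_le_iSup_inf := by
      intro f S m
      rw [inf_apply, sSup_apply, inf_iSup₂_eq]
      refine iSup₂_le fun g hg => ?_
      have : f ⊓ g ≤ ⨆ g ∈ S, f ⊓ g := le_iSup₂_of_le g hg le_rfl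
      exact this m }

end ClassifyingArr

variable [MatchedPair J M]

/-- Objects, arrows, source and target of the classifying localic category of a Grothendieck
matched pair. -/
def classifyingLocalic : LocalicGraph.{u} where
  Ob := JIdeal J
  Arr := ClassifyingArr J M
  src :=
    { toFun := fun I => ⟨fun _ => I, fun _ _ _ _ => rfl⟩
      map_inf' := fun _ _ => rfl
      map_top' := rfl
      map_sSup' := fun S => by
        apply ClassifyingArr.ext
        funext m
        rw [ClassifyingArr.sSup_apply, iSup_image, sSup_eq_iSup] }
  tgt :=
    { toFun := fun I => ⟨fun m => JIdeal.pull m I, fun b m n h =>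
        le_antisymm (le_inf (JIdeal.pull_inf_principal_le h I) inf_le_right)
          (le_inf (JIdeal.pull_inf_principal_le h.symm I) inf_le_right)⟩
      map_inf' := fun I K => ClassifyingArr.ext (funext fun m => JIdeal.pull_inf m I K)
      map_top' := ClassifyingArr.ext (funext fun m => JIdeal.pull_top m)
      map_sSup' := fun S => by
        apply ClassifyingArr.ext
        funext m
        rw [ClassifyingArr.sSup_apply, iSup_image, ← sSup_image]
        exact JIdeal.pull_sSup m S }

end Localic

/-! ## The classifying topological category -/

section Topological

/-- A topological category: an internal category in topological spaces. Composition is written in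
diagrammatic order. -/
structure TopologicalCategory where
  Ob : Type u
  Arr : Type u
  [topOb : TopologicalSpace Ob]
  [topArr : TopologicalSpace Arr]
  src : Arr → Ob
  tgt : Arr → Ob
  idn : Ob → Arr
  comp : {p : Arr × Arr // tgt p.1 = src p.2} → Arr
  src_idn : ∀ x, src (idn x) = x
  tgt_idn : ∀ x, tgt (idn x) = x
  src_comp : ∀ p, src (comp p) = src p.1.1
  tgt_comp : ∀ p, tgt (comp p) = tgt p.1.2
  idn_comp : ∀ f, comp ⟨(idn (src f), f), tgt_idn _⟩ = f
  comp_idn : ∀ f, comp ⟨(f, idn (tgt f)), (src_idn _).symm⟩ = f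
  assoc : ∀ (f g h : Arr) (hfg : tgt f = src g) (hgh : tgt g = src h),
    comp ⟨(comp ⟨(f, g), hfg⟩, h), (tgt_comp _).trans hgh⟩ =
      comp ⟨(f, comp ⟨(g, h), hgh⟩), hfg.trans (src_comp ⟨(g, h), hgh⟩).symm⟩
  continuous_src : Continuous src
  continuous_tgt : Continuous tgt
  continuous_idn : Continuous idn
  continuous_comp : Continuous comp

attribute [instance] TopologicalCategory.topOb TopologicalCategory.topArr

/-- Open sieves: open sets of objects that contain the source of an arrow whenever they contain
its target. -/
def TopologicalCategory.IsOpenSieve (C : TopologicalCategory.{u}) (U : Set C.Ob) : Prop :=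
  IsOpen U ∧ ∀ f : C.Arr, C.tgt f ∈ U → C.src f ∈ U

/-- Minimality: the only open sieves are the empty set and the whole space of objects. -/
def TopologicalCategory.IsMinimal (C : TopologicalCategory.{u}) : Prop :=
  ∀ U : Set C.Ob, C.IsOpenSieve U → U = ∅ ∨ U = Set.univ

/-- The ultrafilters of a Boolean algebra. -/
@[ext]
structure BoolUltrafilter (B : Type u) [BooleanAlgebra B] where
  carrier : Set B
  top_mem : ⊤ ∈ carrier
  inf_mem : ∀ b c, b ∈ carrier → c ∈ carrier → b ⊓ c ∈ carrier
  upper : ∀ b c, b ≤ c → b ∈ carrier → c ∈ carrier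
  compl_mem_iff : ∀ b, bᶜ ∈ carrier ↔ b ∉ carrier

variable {B : Type u} [BooleanAlgebra B]

namespace BoolUltrafilter

/-- The Stone topology, with basic open sets `[b]`. -/
instance : TopologicalSpace (BoolUltrafilter B) :=
  TopologicalSpace.generateFrom (Set.range fun b : B => {U | b ∈ U.carrier})

theorem isOpen_basic (b : B) : IsOpen {U : BoolUltrafilter B | b ∈ U.carrier} :=
  TopologicalSpace.isOpen_generateFrom_of_mem ⟨b, rfl⟩

variable (M : Type u) [Monoid M] [MulAction M B] [BSet B M]

/-- `m ≡_U n` just when `m ≡_b n` for some `b ∈ U`. -/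
def germSetoid (U : BoolUltrafilter B) : Setoid M where
  r m n := ∃ b ∈ U.carrier, BSet.EqOn b m n
  iseqv :=
    { refl := fun m => ⟨⊤, U.top_mem, BSet.EqOn.refl _ m⟩
      symm := fun ⟨b, hb, h⟩ => ⟨b, hb, h.symm⟩
      trans := fun ⟨b, hb, h⟩ ⟨c, hc, h'⟩ => ⟨b ⊓ c, U.inf_mem b c hb hc,
        (h.mono inf_le_left).trans (h'.mono inf_le_right)⟩ }

variable (J : ZeroDimTopology B) [BJSet J M] [MatchedPair J M]

variable {M} in
/-- `m_! U`, the ultrafilter of all `b` with `m^* b ∈ U`. -/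
def push (m : M) (U : BoolUltrafilter B) : BoolUltrafilter B where
  carrier := {b | m • b ∈ U.carrier}
  top_mem := by
    change m • (⊤ : B) ∈ U.carrier
    rw [MatchedPair.smul_top (J := J)]
    exact U.top_mem
  inf_mem b c hb hc := by
    change m • (b ⊓ c) ∈ U.carrier
    rw [MatchedPair.smul_inf (J := J)]
    exact U.inf_mem _ _ hb hc
  upper b c h hb := U.upper _ _ (MatchedPair.smul_mono J m h) hb
  compl_mem_iff b := by
    change m • bᶜ ∈ U.carrier ↔ m • b ∉ U.carrier
    rw [MatchedPair.smul_compl J]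
    exact U.compl_mem_iff _

theorem push_eq_of_germ {U : BoolUltrafilter B} {m n : M} (h : (germSetoid M U).r m n) :
    push J m U = push J n U := by
  obtain ⟨b, hb, h⟩ := h
  have key : ∀ c, b ⊓ m • c = b ⊓ n • c := MatchedPair.inf_smul_eq J h
  ext c
  change m • c ∈ U.carrier ↔ n • c ∈ U.carrier
  constructor
  · intro hc
    exact U.upper _ _ inf_le_right (key c ▸ U.inf_mem _ _ hb hc)
  · intro hc
    exact U.upper _ _ inf_le_right ((key c).symm ▸ U.inf_mem _ _ hb hc)

theorem push_one (U : BoolUltrafilter B) : push J (1 : M) U = U := by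
  ext c
  change (1 : M) • c ∈ U.carrier ↔ _
  rw [one_smul]

theorem push_mul (U : BoolUltrafilter B) (m n : M) : push J (m * n) U = push J n (push J m U) := by
  ext c
  change (m * n) • c ∈ U.carrier ↔ m • n • c ∈ U.carrier
  rw [mul_smul]

end BoolUltrafilter

open BoolUltrafilter

variable (B) (M : Type u) [Monoid M] [MulAction M B] [BSet B M]

/-- The arrows of the classifying topological category. -/
def GermArr : Type u := Σ U : BoolUltrafilter B, Quotient (germSetoid M U)

variable {B M}

/-- The arrow `(U, m)`. -/
def GermArr.mk (U : BoolUltrafilter B) (m : M) : GermArr B M := ⟨U, Quotient.mk _ m⟩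

theorem GermArr.exists_eq (f : GermArr B M) : ∃ m, f = GermArr.mk f.1 m := by
  obtain ⟨U, m⟩ := f
  induction m using Quotient.inductionOn with | h m => exact ⟨m, rfl⟩

theorem GermArr.mk_eq {U : BoolUltrafilter B} {m n : M} {b : B} (hb : b ∈ U.carrier)
    (h : BSet.EqOn b m n) : GermArr.mk U m = GermArr.mk U n := by
  have : (Quotient.mk (germSetoid M U) m) = Quotient.mk _ n := Quotient.sound ⟨b, hb, h⟩
  unfold GermArr.mk
  rw [this]

theorem GermArr.exists_of_mk_eq {U V : BoolUltrafilter B} {m n : M}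
    (h : GermArr.mk U m = GermArr.mk V n) : U = V ∧ ∃ b ∈ U.carrier, BSet.EqOn b m n := by
  have h1 : U = V := congrArg Sigma.fst h
  subst h1
  have h2 := eq_of_heq (Sigma.mk.inj h).2
  exact ⟨rfl, Quotient.exact h2⟩

/-- The set of arrows `(U, m)` with `b ∈ U`, for given `b` and `m`. -/
def GermArr.basic (b : B) (m : M) : Set (GermArr B M) := {f | ∃ U, b ∈ U.carrier ∧ f = .mk U m}

/-- The topology with basic open sets `GermArr.basic b m`. -/
instance : TopologicalSpace (GermArr B M) :=
  TopologicalSpace.generateFrom {S | ∃ (b : B) (m : M), S = GermArr.basic b m}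

theorem GermArr.isOpen_basic (b : B) (m : M) : IsOpen (GermArr.basic b m) :=
  TopologicalSpace.isOpen_generateFrom_of_mem ⟨b, m, rfl⟩

variable (J : ZeroDimTopology B) [BJSet J M] [MatchedPair J M]

/-- The target of `(U, m)` is `m_! U`. -/
def GermArr.tgt (f : GermArr B M) : BoolUltrafilter B :=
  Quotient.lift (fun m : M => BoolUltrafilter.push J m f.1)
    (fun _ _ h => push_eq_of_germ M J h) f.2

theorem GermArr.tgt_mk (U : BoolUltrafilter B) (m : M) : GermArr.tgt J (.mk U m) = push J m U := rfl

/-- The composite of `(U, m)` and `(m_! U, n)` is `(U, mn)`, as the next lemma shows. -/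
noncomputable def GermArr.comp (f g : GermArr B M) : GermArr B M :=
  .mk f.1 (f.2.out * g.2.out)

theorem GermArr.comp_mk {U V : BoolUltrafilter B} {m n : M} (h : push J m U = V) :
    GermArr.comp (.mk U m) (.mk V n) = .mk U (m * n) := by
  subst h
  obtain ⟨b, hb, h1⟩ := Quotient.exact (Quotient.out_eq (Quotient.mk (germSetoid M U) m))
  obtain ⟨c, hc, h2⟩ := Quotient.exact
    (Quotient.out_eq (Quotient.mk (germSetoid M (push J m U)) n))
  refine GermArr.mk_eq (U.inf_mem b (m • c) hb hc) ?_
  exact ((MatchedPair.mul_eqOn J h1 _).mono inf_le_left).trans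
    ((MatchedPair.eqOn_mul J m h2).mono inf_le_right)

theorem GermArr.tgt_comp_mk {U V : BoolUltrafilter B} {m n : M} (h : push J m U = V) :
    GermArr.tgt J (GermArr.comp (.mk U m) (.mk V n)) = push J n V := by
  rw [GermArr.comp_mk J h, GermArr.tgt_mk, push_mul, h]

variable (M)

/-- The classifying topological category of a matched pair. -/
noncomputable def classifyingTopological : TopologicalCategory.{u} where
  Ob := BoolUltrafilter B
  Arr := GermArr B M
  src f := f.1
  tgt := GermArr.tgt J
  idn U := .mk U 1
  comp p := GermArr.comp p.1.1 p.1.2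
  src_idn _ := rfl
  tgt_idn U := push_one M J U
  src_comp _ := rfl
  tgt_comp := by
    rintro ⟨⟨f, g⟩, h⟩
    obtain ⟨m, hf⟩ := f.exists_eq
    obtain ⟨n, hg⟩ := g.exists_eq
    change GermArr.tgt J f = g.1 at h
    change GermArr.tgt J (GermArr.comp f g) = GermArr.tgt J g
    rw [hf, GermArr.tgt_mk] at h
    rw [hf, hg, GermArr.tgt_comp_mk J h, GermArr.tgt_mk]
  idn_comp f := by
    obtain ⟨m, hf⟩ := f.exists_eq
    change GermArr.comp (.mk f.1 1) f = f
    conv_lhs => rw [hf]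
    rw [show (GermArr.mk f.1 m).1 = f.1 from rfl, GermArr.comp_mk J (push_one M J f.1), one_mul,
      ← hf]
  comp_idn f := by
    obtain ⟨m, hf⟩ := f.exists_eq
    change GermArr.comp f (.mk (GermArr.tgt J f) 1) = f
    rw [hf, GermArr.comp_mk J (by rw [GermArr.tgt_mk]), mul_one]
  assoc f g h hfg hgh := by
    obtain ⟨m, hf⟩ := f.exists_eq
    obtain ⟨n, hg⟩ := g.exists_eq
    obtain ⟨p, hh⟩ := h.exists_eq
    change GermArr.comp (GermArr.comp f g) h = GermArr.comp f (GermArr.comp g h)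
    rw [hf, GermArr.tgt_mk] at hfg
    rw [hg, GermArr.tgt_mk] at hgh
    rw [hf, hg, hh, GermArr.comp_mk J hfg, GermArr.comp_mk J hgh, GermArr.comp_mk J hfg,
      GermArr.comp_mk J (by rw [push_mul, hfg, hgh]), mul_assoc]
  continuous_src := by
    refine continuous_generateFrom_iff.2 ?_
    rintro _ ⟨b, rfl⟩
    have : (fun f : GermArr B M => f.1) ⁻¹' {U | b ∈ U.carrier} =
        ⋃ m : M, GermArr.basic b m := by
      ext f
      simp only [Set.mem_preimage, Set.mem_ofPred_eq, Set.mem_iUnion]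
      constructor
      · intro hb
        obtain ⟨m, hf⟩ := f.exists_eq
        exact ⟨m, f.1, hb, hf⟩
      · rintro ⟨m, U, hb, rfl⟩
        exact hb
    rw [this]
    exact isOpen_iUnion fun m => GermArr.isOpen_basic b m
  continuous_tgt := by
    refine continuous_generateFrom_iff.2 ?_
    rintro _ ⟨b, rfl⟩
    have : (GermArr.tgt J) ⁻¹' {U | b ∈ U.carrier} =
        ⋃ m : M, GermArr.basic (m • b) m := by
      ext f
      simp only [Set.mem_preimage, Set.mem_ofPred_eq, Set.mem_iUnion]
      constructor
      · intro hb
        obtain ⟨m, hf⟩ := f.exists_eq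
        rw [hf] at hb
        exact ⟨m, f.1, hb, hf⟩
      · rintro ⟨m, U, hb, rfl⟩
        exact hb
    rw [this]
    exact isOpen_iUnion fun m => GermArr.isOpen_basic _ m
  continuous_idn := by
    refine continuous_generateFrom_iff.2 ?_
    rintro _ ⟨b, m, rfl⟩
    have : (fun U : BoolUltrafilter B => GermArr.mk U (1 : M)) ⁻¹' GermArr.basic b m =
        ⋃ c : {c : B // BSet.EqOn c (1 : M) m}, {U | b ⊓ c.1 ∈ U.carrier} := by
      ext U
      simp only [Set.mem_preimage, Set.mem_ofPred_eq, Set.mem_iUnion]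
      constructor
      · rintro ⟨V, hb, h⟩
        obtain ⟨rfl, c, hc, hc'⟩ := GermArr.exists_of_mk_eq h
        exact ⟨⟨c, hc'⟩, U.inf_mem _ _ hb hc⟩
      · rintro ⟨c, hc⟩
        exact ⟨U, U.upper _ _ inf_le_left hc,
          GermArr.mk_eq (U.upper _ _ inf_le_right hc) c.2⟩
    rw [this]
    exact isOpen_iUnion fun c => BoolUltrafilter.isOpen_basic _
  continuous_comp := by
    refine continuous_generateFrom_iff.2 ?_
    rintro _ ⟨b, p, rfl⟩
    rw [isOpen_iff_forall_mem_open]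
    rintro ⟨⟨f, g⟩, hfg⟩ ⟨U, hb, hU⟩
    obtain ⟨m, hf⟩ := f.exists_eq
    obtain ⟨n, hg⟩ := g.exists_eq
    change GermArr.tgt J f = g.1 at hfg
    change GermArr.comp f g = _ at hU
    rw [hf, GermArr.tgt_mk] at hfg
    rw [hf, hg, GermArr.comp_mk J hfg] at hU
    obtain ⟨hfU, c, hc, hc'⟩ := GermArr.exists_of_mk_eq hU
    refine ⟨(Subtype.val ⁻¹' (GermArr.basic (b ⊓ c) m ×ˢ GermArr.basic ⊤ n)), ?_,
      ((GermArr.isOpen_basic _ _).prod (GermArr.isOpen_basic _ _)).preimage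
        continuous_subtype_val, ⟨f.1, f.1.inf_mem _ _ (hfU ▸ hb) hc, hf⟩, g.1, g.1.top_mem, hg⟩
    rintro ⟨⟨f', g'⟩, h'⟩ ⟨⟨U', hU', hf'⟩, V', -, hg'⟩
    change f' = _ at hf'
    change g' = _ at hg'
    subst hf' hg'
    change GermArr.tgt J (.mk U' m) = V' at h'
    rw [GermArr.tgt_mk] at h'
    refine ⟨U', U'.upper _ _ inf_le_left hU', ?_⟩
    change GermArr.comp _ _ = _
    rw [GermArr.comp_mk J h']
    exact GermArr.mk_eq (U'.upper _ _ inf_le_right hU') hc'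

end Topological

/-!
The hub of the argument is the first condition: every non-zero `b` in `B` has some `m` with
`m^* b = 1`. Each of the other conditions is shown to be equivalent to it.

*From the first condition.* If `m^* b = 1`, then a section of a sheaf on `b` is moved by `m` to a
global section. So a sheaf without global sections is empty, hence initial, and one with a global
section has sections everywhere, hence is well-supported (`isTwoValued`). Moreover every local
section extends to a global one (`BMPresheaf.IsSheaf.res_surjective`), so that the sheaf is
recovered as `B ∧ X(1)`; as `B ∧ (-)` is always fully faithful, it is an equivalence
(`wedge_isEquivalence`). The category of `⟨B_J|M⟩`-sets is always cartesian closed with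
pullbacks, the exponential being `Hom(M × X, Y)`. Its object of truth values consists of the left ideals of `M`
that are closed under gluing, two of them being equal on `b` when they contain the same `m` with
`m^* b = 1`. The first condition provides enough such `m` for this relation to be local
(`BMSet.Sub.idealEqOn_of_inf`), and then the ideals `{m | m • x ∈ S}` classify the subobject
`S` (`BMSet.hasSubobjectClassifier`). A set with operations `b(-,-)` and `P(-)` is determined by
its relations `≡_b`, and is best constructed from them (`BMSet.LocalEquality.toBMSet`).

*Back to the first condition.* The set `I` of all `c` with `c ≤ m^* b` for some `m` is already a
`J`-closed ideal, since the various `m` can be glued in `M` (`JIdeal.generated`). It is stable under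
`M`, and it suffices to see that it contains `1`. Open sieves of the localic category are the same
as stable ideals, which settles minimality; an ultrafilter that misses a proper `I` settles the
topological case. For the sheaf conditions, consider the subterminal sheaf with a section on `c`
when `c ∈ I`. If it is of the form `B ∧ X`, then `X` is non-empty, so there is a global section. If
it is well-supported, then the global elements `0` and `1` of `B ∧ (B / I)`, which agree on it, are
equal. Finally, if there is a subobject classifier and `I` is proper, then the characteristic map
of `0` in `B / I` and that of `0` in `B` both send `0` to `true` and `1` to `false`, so they send
`b` to the same truth value (`BMSet.χ_botPoint_apply`); it is `true` as `b ∈ I`, and so `b = 0` in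
`B`.
-/

/-! ### Partitions and gluing -/

section Partitions

variable {B : Type u} [BooleanAlgebra B]

namespace ZeroDimTopology

variable (J : ZeroDimTopology B)

theorem pair_compl_mem_parts (b : B) : ({b, bᶜ} \ {⊥} : Set B) ∈ J.parts := by
  refine J.finite_mem _ ⟨by simp, ⟨fun _ _ => le_top, fun z hz => ?_⟩, ?_⟩
    ((Set.toFinite _).subset Set.sdiff_subset)
  · have key : ∀ c ∈ ({b, bᶜ} : Set B), c ≤ z := fun c hc => by
      by_cases h : c = ⊥
      · exact h ▸ bot_le
      · exact hz ⟨hc, h⟩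
    rw [← sup_compl_eq_top (x := b)]
    exact sup_le (key _ (by simp)) (key _ (by simp))
  · rintro c ⟨hc, -⟩ d ⟨hd, -⟩ hne
    simp only [Set.mem_insert_iff, Set.mem_singleton_iff] at hc hd
    rcases hc with rfl | rfl <;> rcases hd with rfl | rfl <;> simp_all

variable {J}

theorem mem_covers_top {P : Set B} (hP : P ∈ J.parts) : P ∈ J.covers ⊤ :=
  ⟨P, hP, subset_rfl, (J.isPartition P hP).isLUB⟩

theorem ne_bot_of_mem_covers {P : Set B} {b p : B} (hP : P ∈ J.covers b) (hp : p ∈ P) :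
    p ≠ ⊥ := by
  obtain ⟨Q, hQ, hPQ, -⟩ := hP
  rintro rfl
  exact (J.isPartition Q hQ).bot_notMem (hPQ hp)

theorem nonempty_of_mem_covers {P : Set B} {b : B} (hP : P ∈ J.covers b) (hb : b ≠ ⊥) :
    P.Nonempty := by
  obtain ⟨Q, -, -, hl⟩ := hP
  by_contra h
  rw [Set.not_nonempty_iff_eq_empty] at h
  subst h
  exact hb (isLUB_empty_iff.1 hl).eq_bot

/-- Any part of a partition in the topology has a join. -/
theorem exists_isLUB_of_subset {P S : Set B} (hP : P ∈ J.parts) (hS : S ⊆ P) :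
    ∃ e, IsLUB S e := by
  by_cases hne : S.Nonempty
  · obtain ⟨s, hs⟩ := hne
    -- Collapse `P` along the indicator function of `S`, corestricted to its range.
    let α : P → ULift.{u} Prop := fun p => ⟨p.1 ∈ S⟩
    obtain ⟨j, hj, -⟩ := J.collapse_mem P hP (Set.range α) (Set.rangeFactorization α)
      Set.rangeFactorization_surjective
    have hT : (⟨True⟩ : ULift.{u} Prop) ∈ Set.range α :=
      ⟨⟨s, hS hs⟩, ULift.ext _ _ (by simp [α, hs])⟩
    refine ⟨j ⟨_, hT⟩, ?_⟩
    convert hj ⟨_, hT⟩ using 1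
    ext b
    constructor
    · intro hb
      exact ⟨hS hb, Subtype.ext (ULift.ext _ _ (by simp [α, hb]))⟩
    · rintro ⟨hb, h⟩
      have := congrArg (fun x => x.1.down) h
      simpa [α, Set.rangeFactorization] using this
  · rw [Set.not_nonempty_iff_eq_empty] at hne
    subst hne
    exact ⟨⊥, isLUB_empty⟩

/-- A family of elements indexed by a partition in the topology can be glued. -/
theorem exists_inf_eq {P : Set B} (hP : P ∈ J.parts) (x : B → B) :
    ∃ z, ∀ p ∈ P, p ⊓ z = p ⊓ x p := by
  obtain ⟨z, hz⟩ := exists_isLUB_of_subset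
    (J.refine_mem P hP (fun p => {x p, (x p)ᶜ} \ {⊥}) fun p _ => J.pair_compl_mem_parts (x p))
    (S := {a | a ≠ ⊥ ∧ ∃ p ∈ P, a = p ⊓ x p}) (by
      rintro _ ⟨h0, p, hp, rfl⟩
      exact ⟨⟨p, hp, x p, ⟨by simp, fun h => h0 (by simp_all)⟩, rfl⟩, h0⟩)
  refine ⟨z, fun p hp => le_antisymm (le_inf inf_le_left ?_) (le_inf inf_le_left ?_)⟩
  · rw [inf_comm, ← le_himp_iff]
    refine hz.2 ?_
    rintro _ ⟨-, q, hq, rfl⟩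
    rw [le_himp_iff]
    by_cases h : q = p
    · subst h
      exact inf_le_left.trans inf_le_right
    · rw [inf_right_comm, (J.isPartition P hP).disjoint q hq p hp h]
      simp
  · by_cases h : p ⊓ x p = ⊥
    · exact h ▸ bot_le
    · exact hz.1 ⟨h, p, hp, rfl⟩

end ZeroDimTopology

end Partitions

/-! ### Sets over a matched pair, described by local equality -/

namespace BMSet

open BSet

variable {B : Type u} [BooleanAlgebra B] {J : ZeroDimTopology B} {M : Type u} [Monoid M]
  [MulAction M B] [BSet B M] [BJSet J M]

theorem eqOn_of_inf {X : BMSet J M} {P : Set B} (hP : P ∈ J.parts) {b : B} {x y : X.carrier}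
    (h : ∀ p ∈ P, EqOn (b ⊓ p) x y) : EqOn b x y := by
  refine BJSet.eqOn_of_covers
    (ZeroDimTopology.inf_mem_covers (ZeroDimTopology.mem_covers_top hP) (le_top (a := b))) ?_
  rintro _ ⟨⟨p, hp, rfl⟩, -⟩
  exact h p hp

theorem cond_of_eqOn {X : BMSet J M} {b : B} {x y z : X.carrier} (h : EqOn b z x)
    (h' : EqOn bᶜ z y) : cond b x y = z := by
  have h1 := (cond_eqOn b x y).trans h.symm
  have h2 := (cond_eqOn_compl b x y).trans h'.symm
  have h3 := h1.sup h2
  rw [sup_compl_eq_top] at h3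
  exact eqOn_top h3

theorem glue_eq_of_eqOn {X : BMSet J M} {P : Set B} (hP : P ∈ J.parts) (hi : P.Infinite)
    {x : P → X.carrier} {z : X.carrier} (h : ∀ p : P, EqOn p.1 z (x p)) :
    BJSet.glue P hP hi x = z :=
  BJSet.eq_of_eqOn hP fun p hp =>
    EqOn.trans (BJSet.cond_glue P hP hi x ⟨p, hp⟩) (h ⟨p, hp⟩).symm

/-- A function that commutes with the monoid action and preserves all the relations `≡_b`
preserves all the operations. -/
def homMk {X Y : BMSet J M} (f : X.carrier → Y.carrier)
    (hE : ∀ (b : B) x y, EqOn b x y → EqOn b (f x) (f y)) (hs : ∀ (m : M) x, f (m • x) = m • f x) :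
    X ⟶ Y where
  toFun := f
  map_cond b x y := (cond_of_eqOn (hE _ _ _ (cond_eqOn b x y))
    (hE _ _ _ (cond_eqOn_compl b x y))).symm
  map_glue P hP hi x := (glue_eq_of_eqOn hP hi fun p =>
    hE _ _ _ (BJSet.cond_glue P hP hi x p)).symm
  map_smul := hs

@[simp] theorem homMk_toFun {X Y : BMSet J M} (f : X.carrier → Y.carrier) (hE hs) :
    Hom.toFun (homMk f hE hs : X ⟶ Y) = f := rfl

variable (J M) in
/-- The relations `≡_b` of a `⟨B_J|M⟩`-set, axiomatised on an `M`-set. As `b(x,y)` and `P(x)` are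
the unique elements with given restrictions, the relations determine the operations. -/
structure LocalEquality (X : Type u) [MulAction M X] where
  /-- the relation `≡_b` -/
  rel : B → X → X → Prop
  refl : ∀ b x, rel b x x
  symm : ∀ b x y, rel b x y → rel b y x
  trans : ∀ b x y z, rel b x y → rel b y z → rel b x z
  mono : ∀ b c x y, c ≤ b → rel b x y → rel c x y
  bot : ∀ x y, rel ⊥ x y
  top : ∀ x y, rel ⊤ x y → x = y
  locality : ∀ P ∈ J.parts, ∀ b x y, (∀ p ∈ P, rel (b ⊓ p) x y) → rel b x y
  gluing : ∀ P ∈ J.parts, ∀ x : P → X, ∃ z, ∀ p : P, rel p.1 z (x p)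
  smul_left : ∀ (b : B) (m n : M) (x : X), EqOn b m n → rel b (m • x) (n • x)
  smul_right : ∀ (b : B) (m : M) (x y : X), rel b x y → rel (m • b) (m • x) (m • y)

namespace LocalEquality

variable {X : Type u} [MulAction M X] (E : LocalEquality J M X)

theorem sup {b c : B} {x y : X} (h : E.rel b x y) (h' : E.rel c x y) : E.rel (b ⊔ c) x y := by
  refine E.locality _ (J.pair_compl_mem_parts b) _ _ _ ?_
  rintro p ⟨hp, -⟩
  simp only [Set.mem_insert_iff, Set.mem_singleton_iff] at hp
  rcases hp with rfl | rfl
  · exact E.mono _ _ _ _ inf_le_right h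
  · refine E.mono _ _ _ _ ?_ h'
    rw [inf_sup_right, inf_compl_eq_bot, bot_sup_eq]
    exact inf_le_left

theorem eq_of_compl {b : B} {x y : X} (h : E.rel b x y) (h' : E.rel bᶜ x y) : x = y := by
  have := E.sup h h'
  rw [sup_compl_eq_top] at this
  exact E.top _ _ this

theorem exists_cond (b : B) (x y : X) : ∃ z, E.rel b z x ∧ E.rel bᶜ z y := by
  classical
  obtain ⟨z, hz⟩ := E.gluing _ (J.pair_compl_mem_parts b) (fun p => if p.1 = b then x else y)
  refine ⟨z, ?_, ?_⟩
  · by_cases hb : b = ⊥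
    · exact hb ▸ E.bot _ _
    · simpa using hz ⟨b, by simp [hb]⟩
  · by_cases hb : bᶜ = ⊥
    · rw [hb]
      exact E.bot _ _
    · have h := hz ⟨bᶜ, by simpa using hb⟩
      by_cases h' : bᶜ = b
      · -- An element equal to its complement is zero, and so is its complement.
        have h0 : b = ⊥ := by simpa [h'] using (inf_compl_eq_bot (a := b))
        exact absurd (h'.trans h0) hb
      · simpa [h'] using h

variable [MatchedPair J M]

/-- The `⟨B_J|M⟩`-set with the given local equality relations. -/
noncomputable def toBMSet : BMSet J M :=
  have h₁ : ∀ b x y, E.rel b (E.exists_cond b x y).choose x := fun b x y =>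
    (E.exists_cond b x y).choose_spec.1
  have h₂ : ∀ b x y, E.rel bᶜ (E.exists_cond b x y).choose y := fun b x y =>
    (E.exists_cond b x y).choose_spec.2
  have uniq : ∀ b x y z, E.rel b z x → E.rel bᶜ z y → (E.exists_cond b x y).choose = z :=
    fun b x y z h h' => E.eq_of_compl (E.trans _ _ _ _ (h₁ b x y) (E.symm _ _ _ h))
      (E.trans _ _ _ _ (h₂ b x y) (E.symm _ _ _ h'))
  have iff : ∀ b x y, (E.exists_cond b x y).choose = y ↔ E.rel b x y := fun b x y =>
    ⟨fun h => E.symm _ _ _ (by simpa only [h] using h₁ b x y),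
      fun h => uniq _ _ _ _ (E.symm _ _ _ h) (E.refl _ _)⟩
  letI : BSet B X :=
    { cond := fun b x y => (E.exists_cond b x y).choose
      cond_self := fun b x => uniq _ _ _ _ (E.refl _ _) (E.refl _ _)
      cond_cond_left := fun b x y z => uniq _ _ _ _
        (E.trans _ _ _ _ (h₁ b x z) (E.symm _ _ _ (h₁ b x y))) (h₂ b x z)
      cond_cond_right := fun b x y z => uniq _ _ _ _ (h₁ b x z)
        (E.trans _ _ _ _ (h₂ b x z) (E.symm _ _ _ (h₂ b y z)))
      cond_top := fun x y => uniq _ _ _ _ (E.refl _ _) (by rw [compl_top]; exact E.bot _ _)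
      cond_compl := fun b x y => uniq _ _ _ _ (h₂ b y x) (by rw [compl_compl]; exact h₁ b y x)
      cond_inf := fun b c x y => uniq _ _ _ _
        (E.trans _ _ _ _ (E.mono _ _ _ _ inf_le_left (h₁ b _ _))
          (E.mono _ _ _ _ inf_le_right (h₁ c x y))) (by
          rw [compl_inf]
          refine E.sup (h₂ b _ _) ?_
          refine E.locality _ (J.pair_compl_mem_parts b) _ _ _ ?_
          rintro p ⟨hp, -⟩
          simp only [Set.mem_insert_iff, Set.mem_singleton_iff] at hp
          rcases hp with rfl | rfl
          · exact E.trans _ _ _ _ (E.mono _ _ _ _ inf_le_right (h₁ p _ _))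
              (E.mono _ _ _ _ inf_le_left (h₂ c x y))
          · exact E.mono _ _ _ _ inf_le_right (h₂ b _ _)) }
  letI : BJSet J X :=
    have sep : ∀ (P : Set B), P ∈ J.parts → ∀ x y : X, (∀ p : P, E.rel p.1 x y) → x = y :=
      fun P hP x y h => E.top _ _ (E.locality P hP _ _ _ fun p hp => by
        rw [top_inf_eq]
        exact h ⟨p, hp⟩)
    { glue := fun P hP _ x => (E.gluing P hP x).choose
      glue_const := fun P hP _ x => sep P hP _ _ (E.gluing P hP fun _ => x).choose_spec
      glue_cond := fun P hP _ x y => sep P hP _ _ fun p =>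
        E.trans _ _ _ _ ((E.gluing P hP _).choose_spec p)
          (E.trans _ _ _ _ (h₁ _ _ _) (E.symm _ _ _ ((E.gluing P hP x).choose_spec p)))
      cond_glue := fun P hP _ x p => (iff _ _ _).2 ((E.gluing P hP x).choose_spec p) }
  { carrier := X
    cond_smul := fun b m n x => (uniq _ _ _ _ (E.smul_left _ _ _ _ (cond_eqOn b m n))
      (E.smul_left _ _ _ _ (cond_eqOn_compl b m n))).symm
    smul_cond := fun m b x y => by
      refine (uniq _ _ _ _ (E.smul_right _ _ _ _ (h₁ b x y)) ?_).symm
      rw [← MatchedPair.smul_compl J]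
      exact E.smul_right _ _ _ _ (h₂ b x y) }

theorem toBMSet_eqOn {b : B} {x y : X} :
    EqOn (X := E.toBMSet.carrier) b x y ↔ E.rel b x y := by
  have h₁ : E.rel b (E.exists_cond b x y).choose x := (E.exists_cond b x y).choose_spec.1
  have h₂ : E.rel bᶜ (E.exists_cond b x y).choose y := (E.exists_cond b x y).choose_spec.2
  change (E.exists_cond b x y).choose = y ↔ _
  exact ⟨fun h => E.symm _ _ _ (by simpa only [h] using h₁),
    fun h => E.eq_of_compl (E.trans _ _ _ _ h₁ h) h₂⟩

end LocalEquality

variable [MatchedPair J M]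

theorem eqOn_of_inf_smul {X : BMSet J M} {P : Set B} (hP : P ∈ J.parts) (m : M) {b : B}
    {x y : X.carrier} (h : ∀ p ∈ P, EqOn (b ⊓ m • p) x y) : EqOn b x y := by
  refine eqOn_of_inf (MatchedPair.smul_mem m P hP) ?_
  rintro _ ⟨⟨p, hp, rfl⟩, -⟩
  exact h p hp

/-- Distinct blocks of a partition have disjoint images under `m^*`, so a family indexed
by `P` can be glued along the partition `m^* P`. -/
theorem exists_eqOn_smul {X : BMSet J M} [Nontrivial B] {P : Set B} (hP : P ∈ J.parts) (m : M)
    (y : P → X.carrier) : ∃ z, ∀ p : P, EqOn (m • p.1) z (y p) := by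
  classical
  obtain ⟨p₀, hp₀⟩ := ZeroDimTopology.nonempty_of_mem_covers
    (ZeroDimTopology.mem_covers_top hP) top_ne_bot
  have : Nonempty X.carrier := ⟨y ⟨p₀, hp₀⟩⟩
  obtain ⟨z, hz⟩ := BJSet.exists_eqOn (MatchedPair.smul_mem m P hP)
    (fun q => if h : ∃ p : P, m • p.1 = q then y h.choose else y ⟨p₀, hp₀⟩)
  refine ⟨z, fun p => ?_⟩
  by_cases h0 : m • p.1 = ⊥
  · exact h0 ▸ eqOn_bot _ _
  have hz' := hz (m • p.1) ⟨⟨p.1, p.2, rfl⟩, h0⟩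
  have hex : ∃ q : P, m • q.1 = m • p.1 := ⟨p, rfl⟩
  rw [dif_pos hex] at hz'
  have hq : hex.choose = p := by
    by_contra hne
    have hd := (J.isPartition P hP).disjoint _ hex.choose.2 _ p.2 fun h => hne (Subtype.ext h)
    have h1 : m • (hex.choose.1 ⊓ p.1) = m • p.1 := by
      rw [MatchedPair.smul_inf (J := J), hex.choose_spec, inf_idem]
    rw [hd, MatchedPair.smul_bot (J := J)] at h1
    exact h0 h1.symm
  rwa [hq] at hz'

/-! ### Subobjects, products and pullbacks -/

/-- A subset of a `⟨B_J|M⟩`-set that is closed under the operations. Closure under the operations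
of the `B_J`-set is expressed by saying that an element which agrees locally with elements of
the subset belongs to it. The empty subset is allowed. -/
@[ext]
structure Sub (X : BMSet J M) where
  carrier : Set X.carrier
  smul_mem : ∀ (m : M), ∀ x ∈ carrier, m • x ∈ carrier
  local_mem : ∀ P ∈ J.parts, ∀ x, (∀ p ∈ P, ∃ s ∈ carrier, EqOn p s x) → x ∈ carrier

namespace Sub

variable {X : BMSet J M}

instance (S : Sub X) : MulAction M S.carrier where
  smul m x := ⟨m • x.1, S.smul_mem m _ x.2⟩
  one_smul x := Subtype.ext (one_smul M x.1)
  mul_smul m n x := Subtype.ext (mul_smul m n x.1)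

/-- Local equality on a closed subset is inherited. -/
def localEquality [Nontrivial B] (S : Sub X) : LocalEquality J M S.carrier where
  rel b x y := EqOn b x.1 y.1
  refl _ _ := EqOn.refl _ _
  symm _ _ _ h := h.symm
  trans _ _ _ _ h h' := h.trans h'
  mono _ _ _ _ hc h := h.mono hc
  bot _ _ := eqOn_bot _ _
  top _ _ h := Subtype.ext (eqOn_top h)
  locality _ hP _ _ _ h := eqOn_of_inf hP h
  gluing P hP x := by
    obtain ⟨z, hz⟩ := exists_eqOn_smul hP (1 : M) fun p => (x p).1
    simp only [one_smul] at hz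
    exact ⟨⟨z, S.local_mem P hP z fun p hp => ⟨_, (x ⟨p, hp⟩).2, (hz ⟨p, hp⟩).symm⟩⟩, hz⟩
  smul_left _ _ _ _ h := smul_eqOn h _
  smul_right _ _ _ _ h := eqOn_smul _ h

variable [Nontrivial B]

/-- A closed subset as a `⟨B_J|M⟩`-set. -/
noncomputable def toBMSet (S : Sub X) : BMSet J M := S.localEquality.toBMSet

/-- The inclusion of a closed subset. -/
noncomputable def ι (S : Sub X) : S.toBMSet ⟶ X :=
  homMk (X := S.toBMSet) (fun x : S.carrier => x.1)
    (fun _ _ _ h => S.localEquality.toBMSet_eqOn.1 h) fun _ _ => rfl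

/-- A homomorphism with values in a closed subset factors through it. -/
noncomputable def lift (S : Sub X) {Y : BMSet J M} (f : Y ⟶ X)
    (hf : ∀ y, Hom.toFun f y ∈ S.carrier) : Y ⟶ S.toBMSet :=
  homMk (Y := S.toBMSet) (fun y => (⟨Hom.toFun f y, hf y⟩ : S.carrier))
    (fun _ _ _ h => S.localEquality.toBMSet_eqOn.2 (Hom.map_eqOn f h))
    fun m y => Subtype.ext (Hom.map_smul f m y)

theorem hom_ext_ι (S : Sub X) {Y : BMSet J M} {f g : Y ⟶ S.toBMSet} (h : f ≫ S.ι = g ≫ S.ι) :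
    f = g :=
  hom_ext (funext fun y => Subtype.ext (congrFun (congrArg Hom.toFun h) y))

variable (X) in
/-- The empty subset. -/
def empty : Sub X where
  carrier := ∅
  smul_mem _ _ h := h
  local_mem P hP x h := by
    obtain ⟨p, hp⟩ := ZeroDimTopology.nonempty_of_mem_covers
      (ZeroDimTopology.mem_covers_top hP) top_ne_bot
    obtain ⟨s, hs, -⟩ := h p hp
    exact hs

/-- The closed subset on which two homomorphisms agree. -/
def equalizer {Y : BMSet J M} (f g : X ⟶ Y) : Sub X where
  carrier := {x | Hom.toFun f x = Hom.toFun g x}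
  smul_mem m x h := (Hom.map_smul f m x).trans
    ((congrArg (m • ·) h).trans (Hom.map_smul g m x).symm)
  local_mem P hP x h := BJSet.eq_of_eqOn hP fun p hp => by
    obtain ⟨s, hs, hsx⟩ := h p hp
    have h1 := (Hom.map_eqOn f hsx).symm
    rw [show Hom.toFun f s = Hom.toFun g s from hs] at h1
    exact h1.trans (Hom.map_eqOn g hsx)

end Sub

variable (J M) in
/-- The one-element `⟨B_J|M⟩`-set. -/
noncomputable def one : BMSet J M :=
  letI : MulAction M PUnit.{u + 1} :=
    { smul := fun _ x => x, one_smul := fun _ => rfl, mul_smul := fun _ _ _ => rfl }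
  LocalEquality.toBMSet (X := PUnit.{u + 1})
    { rel := fun _ _ _ => True
      refl := fun _ _ => trivial
      symm := fun _ _ _ _ => trivial
      trans := fun _ _ _ _ _ _ => trivial
      mono := fun _ _ _ _ _ _ => trivial
      bot := fun _ _ => trivial
      top := fun _ _ _ => rfl
      locality := fun _ _ _ _ _ _ => trivial
      gluing := fun _ _ _ => ⟨PUnit.unit, fun _ => trivial⟩
      smul_left := fun _ _ _ _ _ => trivial
      smul_right := fun _ _ _ _ _ => trivial }

theorem one_eq (x y : (one J M).carrier) : x = y := PUnit.ext x y

variable (J M) in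
/-- The element of the one-element `⟨B_J|M⟩`-set. -/
def pt : (one J M).carrier := PUnit.unit

/-- The homomorphism `1 → X` given by an `M`-invariant element. -/
noncomputable def point {X : BMSet J M} (e : X.carrier) (he : ∀ m : M, m • e = e) : one J M ⟶ X :=
  homMk (fun _ => e) (fun _ _ _ _ => EqOn.refl _ _) fun m _ => (he m).symm

variable (J M) in
/-- The one-element `⟨B_J|M⟩`-set is terminal. -/
noncomputable def isTerminalOne : IsTerminal (one J M) :=
  IsTerminal.ofUniqueHom
    (fun _ => homMk (fun _ => pt J M)
      (fun _ _ _ _ => EqOn.refl _ _) fun _ _ => one_eq _ _)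
    fun _ _ => hom_ext (funext fun _ => one_eq _ _)

variable [Nontrivial B]

/-- Local equality in a product. -/
def prodLocalEquality (X Y : BMSet J M) : LocalEquality J M (X.carrier × Y.carrier) where
  rel b x y := EqOn b x.1 y.1 ∧ EqOn b x.2 y.2
  refl _ _ := ⟨EqOn.refl _ _, EqOn.refl _ _⟩
  symm _ _ _ h := ⟨h.1.symm, h.2.symm⟩
  trans _ _ _ _ h h' := ⟨h.1.trans h'.1, h.2.trans h'.2⟩
  mono _ _ _ _ hc h := ⟨h.1.mono hc, h.2.mono hc⟩
  bot _ _ := ⟨eqOn_bot _ _, eqOn_bot _ _⟩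
  top _ _ h := Prod.ext (eqOn_top h.1) (eqOn_top h.2)
  locality _ hP _ _ _ h :=
    ⟨eqOn_of_inf hP fun p hp => (h p hp).1, eqOn_of_inf hP fun p hp => (h p hp).2⟩
  gluing P hP x := by
    obtain ⟨z, hz⟩ := exists_eqOn_smul hP (1 : M) fun p => (x p).1
    obtain ⟨w, hw⟩ := exists_eqOn_smul hP (1 : M) fun p => (x p).2
    simp only [one_smul] at hz hw
    exact ⟨(z, w), fun p => ⟨hz p, hw p⟩⟩
  smul_left _ _ _ _ h := ⟨smul_eqOn h _, smul_eqOn h _⟩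
  smul_right _ _ _ _ h := ⟨eqOn_smul _ h.1, eqOn_smul _ h.2⟩

/-- The product of two `⟨B_J|M⟩`-sets. -/
noncomputable def prod (X Y : BMSet J M) : BMSet J M := (prodLocalEquality X Y).toBMSet

theorem prod_eqOn {X Y : BMSet J M} {b : B} {x x' : X.carrier} {y y' : Y.carrier} :
    EqOn (X := (prod X Y).carrier) b (x, y) (x', y') ↔ EqOn b x x' ∧ EqOn b y y' :=
  (prodLocalEquality X Y).toBMSet_eqOn

/-- The first projection. -/
noncomputable def prodFst (X Y : BMSet J M) : prod X Y ⟶ X :=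
  homMk (X := prod X Y) (fun p : X.carrier × Y.carrier => p.1) (fun _ _ _ h => (prod_eqOn.1 h).1)
    fun _ _ => rfl

/-- The second projection. -/
noncomputable def prodSnd (X Y : BMSet J M) : prod X Y ⟶ Y :=
  homMk (X := prod X Y) (fun p : X.carrier × Y.carrier => p.2) (fun _ _ _ h => (prod_eqOn.1 h).2)
    fun _ _ => rfl

/-- The pairing of two homomorphisms. -/
noncomputable def prodLift {X Y Z : BMSet J M} (f : Z ⟶ X) (g : Z ⟶ Y) : Z ⟶ prod X Y :=
  homMk (Y := prod X Y) (fun z => ((Hom.toFun f z, Hom.toFun g z) : X.carrier × Y.carrier))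
    (fun _ _ _ h => prod_eqOn.2 ⟨Hom.map_eqOn f h, Hom.map_eqOn g h⟩)
    fun m z => Prod.ext (Hom.map_smul f m z) (Hom.map_smul g m z)

theorem prod_hom_ext {X Y Z : BMSet J M} {f g : Z ⟶ prod X Y}
    (h₁ : f ≫ prodFst X Y = g ≫ prodFst X Y) (h₂ : f ≫ prodSnd X Y = g ≫ prodSnd X Y) : f = g :=
  hom_ext (funext fun z => Prod.ext (congrFun (congrArg Hom.toFun h₁) z)
    (congrFun (congrArg Hom.toFun h₂) z))

theorem hasPullbacks : HasPullbacks (BMSet J M) := by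
  refine @hasPullbacks_of_hasLimit_cospan _ _ fun {X Y Z} {f} {g} => ?_
  let S : Sub (prod X Y) := Sub.equalizer (prodFst X Y ≫ f) (prodSnd X Y ≫ g)
  have w : (S.ι ≫ prodFst X Y) ≫ f = (S.ι ≫ prodSnd X Y) ≫ g :=
    hom_ext (funext fun x : S.carrier => x.2)
  exact ⟨⟨_, PullbackCone.IsLimit.mk w
    (fun s => S.lift (prodLift s.fst s.snd) fun y =>
      congrFun (congrArg Hom.toFun s.condition) y)
    (fun s => rfl) (fun s => rfl) fun s m h₁ h₂ => S.hom_ext_ι (prod_hom_ext h₁ h₂)⟩⟩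

variable (J M) in
/-- The cartesian monoidal structure given by products. -/
@[reducible]
noncomputable def cartesianMonoidal : CartesianMonoidalCategory (BMSet J M) :=
  .ofChosenFiniteProducts ⟨_, isTerminalOne J M⟩ fun X Y =>
    ⟨BinaryFan.mk (prodFst X Y) (prodSnd X Y), BinaryFan.IsLimit.mk _ prodLift
      (fun _ _ => rfl) (fun _ _ => rfl) fun _ _ _ h₁ h₂ => prod_hom_ext h₁ h₂⟩

/-! ### Exponentials -/

/-- The homomorphisms `M × X → Y`, as functions of two variables: they commute with the action
and preserve local equality. -/
@[ext]
structure Exp (X Y : BMSet J M) where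
  val : M → X.carrier → Y.carrier
  map_smul : ∀ (m n : M) x, val (m * n) (m • x) = m • val n x
  map_eqOn : ∀ (b : B) (n n' : M) x x', EqOn b n n' → EqOn b x x' →
    EqOn b (val n x) (val n' x')

namespace Exp

variable {X Y : BMSet J M}

instance : MulAction M (Exp X Y) where
  smul m f := ⟨fun n x => f.val (n * m) x, fun k n x => by rw [mul_assoc, f.map_smul],
    fun b n n' x x' h h' => f.map_eqOn b _ _ _ _ (MatchedPair.mul_eqOn J h m) h'⟩
  one_smul f := Exp.ext (funext₂ fun n x => congrArg (f.val · x) (mul_one n))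
  mul_smul m m' f := Exp.ext (funext₂ fun n x => congrArg (f.val · x) (mul_assoc n m m').symm)

variable (X Y) in
/-- Two homomorphisms `f, g : M × X → Y` are equal on `b` when `f(n,x)` and `g(n,x)` are equal
on `n^* b`. -/
def localEquality : LocalEquality J M (Exp X Y) where
  rel b f g := ∀ n x, EqOn (n • b) (f.val n x) (g.val n x)
  refl _ _ _ _ := EqOn.refl _ _
  symm _ _ _ h n x := (h n x).symm
  trans _ _ _ _ h h' n x := (h n x).trans (h' n x)
  mono _ _ _ _ hc h n x := (h n x).mono (MatchedPair.smul_mono J n hc)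
  bot _ _ n _ := by rw [MatchedPair.smul_bot (J := J)]; exact eqOn_bot _ _
  top _ _ h := Exp.ext (funext₂ fun n x => eqOn_top (B := B) (by
    have := h n x
    rwa [MatchedPair.smul_top (J := J)] at this))
  locality P hP b f g h n x := eqOn_of_inf_smul hP n fun p hp => by
    rw [← MatchedPair.smul_inf (J := J)]
    exact h p hp n x
  gluing P hP f := by
    choose z hz using fun (n : M) (x : X.carrier) =>
      exists_eqOn_smul hP n fun p : P => (f p).val n x
    refine ⟨⟨z, fun m n x => ?_, fun b n n' x x' h h' => ?_⟩, fun p n x => hz n x p⟩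
    · refine eqOn_top (B := B) (eqOn_of_inf_smul hP (m * n) fun p hp => ?_)
      rw [top_inf_eq]
      refine (hz (m * n) (m • x) ⟨p, hp⟩).trans ?_
      rw [(f _).map_smul, mul_smul]
      exact eqOn_smul m (hz n x ⟨p, hp⟩).symm
    · refine eqOn_of_inf_smul hP n fun p hp => ?_
      refine ((hz n x ⟨p, hp⟩).mono inf_le_right).trans
        ((((f _).map_eqOn b n n' x x' h h').mono inf_le_left).trans ?_)
      rw [MatchedPair.inf_smul_eq J h]
      exact (hz n' x' ⟨p, hp⟩).symm.mono inf_le_right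
  smul_left b m n f h k x :=
    f.map_eqOn _ _ _ _ _ (MatchedPair.eqOn_mul J k h) (EqOn.refl _ _)
  smul_right b m f g h k x := by
    rw [← mul_smul]
    exact h (k * m) x

end Exp

/-- The exponential `Y ^ X`. -/
noncomputable def exp (X Y : BMSet J M) : BMSet J M := (Exp.localEquality X Y).toBMSet

/-- Currying: `x ↦ f(x, a)` is made into a homomorphism `M × X → Y` as `(n, x) ↦ f(x, n • a)`. -/
noncomputable def curryEquiv (X A Y : BMSet J M) : (prod X A ⟶ Y) ≃ (A ⟶ exp X Y) where
  toFun f := homMk (Y := exp X Y)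
    (fun a => (⟨fun n x => Hom.toFun f ((x, n • a) : X.carrier × A.carrier),
      fun m n x => by
        rw [mul_smul]
        exact Hom.map_smul f m ((x, n • a) : X.carrier × A.carrier),
      fun b n n' x x' h h' => Hom.map_eqOn f (prod_eqOn.2 ⟨h', smul_eqOn h a⟩)⟩ : Exp X Y))
    (fun b a a' h => (Exp.localEquality X Y).toBMSet_eqOn.2 fun n x =>
      Hom.map_eqOn f (prod_eqOn.2 ⟨EqOn.refl _ _, eqOn_smul n h⟩))
    (fun m a => Exp.ext (funext₂ fun n x =>
      congrArg (fun a' => Hom.toFun f ((x, a') : X.carrier × A.carrier)) (mul_smul n m a).symm))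
  invFun g := homMk (X := prod X A)
    (fun p : X.carrier × A.carrier => Exp.val (Hom.toFun g p.2) 1 p.1)
    (fun b p q h => by
      obtain ⟨h₁, h₂⟩ := (prodLocalEquality X A).toBMSet_eqOn.1 h
      have h₃ := (Exp.localEquality X Y).toBMSet_eqOn.1 (Hom.map_eqOn g h₂) 1 p.1
      rw [one_smul] at h₃
      exact h₃.trans (Exp.map_eqOn (Hom.toFun g q.2) b 1 1 _ _ (EqOn.refl _ _) h₁))
    (fun m p => by
      change Exp.val (Hom.toFun g (m • p.2)) 1 (m • p.1) = m • Exp.val (Hom.toFun g p.2) 1 p.1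
      rw [Hom.map_smul g]
      change Exp.val (Hom.toFun g p.2) (1 * m) (m • p.1) = _
      rw [one_mul, ← Exp.map_smul (Hom.toFun g p.2), mul_one])
  left_inv f := hom_ext (funext fun p : X.carrier × A.carrier =>
    congrArg (fun a => Hom.toFun f ((p.1, a) : X.carrier × A.carrier)) (one_smul M p.2))
  right_inv g := hom_ext (funext fun a => Exp.ext (funext₂ fun n x => by
    change Exp.val (Hom.toFun g (n • a)) 1 x = Exp.val (Hom.toFun g a) n x
    rw [Hom.map_smul g]
    change Exp.val (Hom.toFun g a) (1 * n) x = _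
    rw [one_mul]))

variable (J M) in
theorem cartesianClosed :
    ∃ _ : CartesianMonoidalCategory (BMSet J M), Nonempty (MonoidalClosed (BMSet J M)) :=
  ⟨cartesianMonoidal J M, ⟨letI := cartesianMonoidal J M
    { closed := fun X =>
        { rightAdj := _
          adj := Adjunction.adjunctionOfEquivRight (F := MonoidalCategory.tensorLeft X)
            (fun A Y => curryEquiv X A Y) fun _ A _ f g =>
              hom_ext (funext fun a => Exp.ext (funext₂ fun n x =>
                congrArg (fun a' => Hom.toFun g ((x, a') : X.carrier × A.carrier))
                  (Hom.map_smul f n a))) } }⟩⟩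

/-! ### The subobject classifier -/

variable (J M) in
/-- The monoid `M` acting on itself: the free `⟨B_J|M⟩`-set on one generator. -/
def self : BMSet J M where
  carrier := M
  cond_smul := MatchedPair.cond_mul (J := J)
  smul_cond m b := MatchedPair.mul_cond (J := J) b m

/-- The homomorphism from the free `⟨B_J|M⟩`-set on one generator that sends the generator
to `x`. -/
def orbit {X : BMSet J M} (x : X.carrier) : self J M ⟶ X :=
  homMk (X := self J M) (fun m : M => m • x) (fun b (m n : M) (h : EqOn b m n) => smul_eqOn h x)
    fun (m n : M) => mul_smul m n x

theorem injective_of_mono {U X : BMSet J M} (i : U ⟶ X) [Mono i] :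
    Function.Injective (Hom.toFun i) := by
  intro x y h
  have : orbit x ≫ i = orbit y ≫ i := hom_ext (funext fun m : M => by
    change Hom.toFun i (m • x) = Hom.toFun i (m • y)
    rw [Hom.map_smul i, Hom.map_smul i, h])
  have h' : (1 : M) • x = (1 : M) • y :=
    congrFun (congrArg Hom.toFun ((cancel_mono i).1 this)) (1 : M)
  simpa using h'

theorem mono_of_injective {U X : BMSet J M} (i : U ⟶ X) (h : Function.Injective (Hom.toFun i)) :
    Mono i :=
  ⟨fun _ _ hfg => hom_ext (funext fun z => h (congrFun (congrArg Hom.toFun hfg) z))⟩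

theorem eqOn_of_injective {U X : BMSet J M} (i : U ⟶ X) (h : Function.Injective (Hom.toFun i))
    {b : B} {x y : U.carrier} (hxy : EqOn b (Hom.toFun i x) (Hom.toFun i y)) : EqOn b x y :=
  h ((Hom.map_cond i b x y).trans hxy)

/-- The image of a homomorphism. -/
def Sub.range {U X : BMSet J M} (i : U ⟶ X) : Sub X where
  carrier := Set.range (Hom.toFun i)
  smul_mem := by
    rintro m _ ⟨x, rfl⟩
    exact ⟨m • x, Hom.map_smul i m x⟩
  local_mem P hP x h := by
    have h' : ∀ p : P, ∃ y, EqOn p.1 (Hom.toFun i y) x := fun p => by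
      obtain ⟨_, ⟨y, rfl⟩, hy⟩ := h p.1 p.2
      exact ⟨y, hy⟩
    choose y hy using h'
    obtain ⟨z, hz⟩ := exists_eqOn_smul hP (1 : M) y
    simp only [one_smul] at hz
    exact ⟨z, BJSet.eq_of_eqOn hP fun p hp =>
      (Hom.map_eqOn i (hz ⟨p, hp⟩)).trans (hy ⟨p, hp⟩)⟩

/-- The characteristic map of `S` sends `x` to the set of those `m` with `m • x` in `S`. -/
def Sub.residual {X : BMSet J M} (S : Sub X) (x : X.carrier) : Sub (self J M) where
  carrier := {m : M | m • x ∈ S.carrier}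
  smul_mem m (n : M) hn := by
    change (m * n) • x ∈ S.carrier
    rw [mul_smul]
    exact S.smul_mem m _ hn
  local_mem P hP n h := S.local_mem P hP _ fun p hp => by
    obtain ⟨s, hs, hsn⟩ := h p hp
    exact ⟨_, hs, smul_eqOn (X := X) (M := M) hsn x⟩

theorem Sub.mem_residual {X : BMSet J M} {S : Sub X} {x : X.carrier} {m : M} :
    m ∈ (S.residual x).carrier ↔ m • x ∈ S.carrier := Iff.rfl

instance : MulAction M (Sub (self J M)) where
  smul m L := L.residual (m : M)
  one_smul L := Sub.ext (Set.ext fun n : M => by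
    change n * 1 ∈ L.carrier ↔ _
    rw [mul_one]
    exact Iff.rfl)
  mul_smul m m' L := Sub.ext (Set.ext fun n : M => by
    change n * (m * m') ∈ L.carrier ↔ (n * m) * m' ∈ L.carrier
    rw [mul_assoc])

theorem Sub.mem_smul {L : Sub (self J M)} {m n : M} :
    n ∈ (m • L).carrier ↔ (n * m : M) ∈ L.carrier := Iff.rfl

theorem Sub.cond_mem {L : Sub (self J M)} {b : B} {m n : M} (hm : m ∈ L.carrier)
    (hn : n ∈ L.carrier) : cond b m n ∈ L.carrier := by
  refine L.local_mem _ (J.pair_compl_mem_parts b) _ ?_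
  rintro p ⟨hp, -⟩
  simp only [Set.mem_insert_iff, Set.mem_singleton_iff] at hp
  rcases hp with rfl | rfl
  · exact ⟨m, hm, (cond_eqOn (X := M) p m n).symm⟩
  · exact ⟨n, hn, (cond_eqOn_compl (X := M) b m n).symm⟩

/-- Equality on `b` of two closed left ideals of `M`: they have the same elements `m` among those
with `m^* b = 1`, that is, among the global sections of the sheaf generated by one section on `b`. -/
def Sub.IdealEqOn (b : B) (L L' : Sub (self J M)) : Prop :=
  ∀ m : M, m • b = ⊤ → (m ∈ L.carrier ↔ m ∈ L'.carrier)

/-- If `L = L'` on `b`, then each element `n` of `L` agrees on `n^* b` with some element of `L'`.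
For `c = n^* b` non-zero, choose `k` with `k^* c = 1`; then `n` agrees on `c` with the element
`c(n, kn)` of `L`, which `b` pulls back to `1`. -/
theorem Sub.IdealEqOn.exists_eqOn (hM : ∀ b : B, b ≠ ⊥ → ∃ m : M, m • b = ⊤) {b : B}
    {L L' : Sub (self J M)} (h : Sub.IdealEqOn b L L') {n : M} (hn : n ∈ L.carrier)
    (h0 : n • b ≠ ⊥) : ∃ s : M, s ∈ L'.carrier ∧ EqOn (n • b) s n := by
  obtain ⟨k, hk⟩ := hM _ h0
  refine ⟨cond (n • b) n (k * n), (h _ ?_).1 (L.cond_mem hn (L.smul_mem k _ hn)),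
    cond_eqOn _ _ _⟩
  rw [MatchedPair.cond_smul (J := J), mul_smul, hk]
  simp

/-- Locality of equality of closed left ideals. The hypothesis on `M` provides, on each piece of
the partition, an element of the second ideal. -/
theorem Sub.idealEqOn_of_inf (hM : ∀ b : B, b ≠ ⊥ → ∃ m : M, m • b = ⊤) {P : Set B}
    (hP : P ∈ J.parts) {b : B} {L L' : Sub (self J M)}
    (h : ∀ p ∈ P, Sub.IdealEqOn (b ⊓ p) L L') : Sub.IdealEqOn b L L' := by
  have key : ∀ {L L' : Sub (self J M)}, (∀ p ∈ P, Sub.IdealEqOn (b ⊓ p) L L') →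
      ∀ m : M, m • b = ⊤ → m ∈ L.carrier → m ∈ L'.carrier := by
    intro L L' h m hm hL
    refine L'.local_mem _ (MatchedPair.smul_mem m P hP) _ ?_
    rintro _ ⟨⟨p, hp, rfl⟩, h0⟩
    have hbp : m • (b ⊓ p) = m • p := by
      rw [MatchedPair.smul_inf (J := J), hm, top_inf_eq]
    obtain ⟨s, hs, hsm⟩ := (h p hp).exists_eqOn hM hL (by rw [hbp]; exact h0)
    rw [hbp] at hsm
    exact ⟨s, hs, hsm⟩
  exact fun m hm => ⟨key h m hm, key (fun p hp n hn => (h p hp n hn).symm) m hm⟩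

/-- Closed left ideals `L_p` glue to the ideal of those `n` which on each `n^* p` agree with
some element of `L_p`. -/
theorem Sub.exists_idealEqOn {P : Set B} (hP : P ∈ J.parts) (L : P → Sub (self J M)) :
    ∃ K : Sub (self J M), ∀ p : P, Sub.IdealEqOn p.1 K (L p) := by
  let A (p : P) (n : M) (c : B) : Prop := c = ⊥ ∨ ∃ l : M, l ∈ (L p).carrier ∧ EqOn c l n
  have A_mono : ∀ p n b c, c ≤ b → A p n b → A p n c := by
    rintro p n b c hc (rfl | ⟨l, hl, h⟩)
    · exact Or.inl (le_bot_iff.1 hc)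
    · exact Or.inr ⟨l, hl, h.mono hc⟩
  refine ⟨⟨{n : M | ∀ p : P, A p n (n • p.1)}, fun m (n : M) hn p => ?_,
    fun Q hQ (n : M) h p => ?_⟩, fun p m hm => ⟨fun h => ?_, fun h p' => ?_⟩⟩
  · change A p (m * n) ((m * n) • p.1)
    rw [mul_smul]
    rcases hn p with h0 | ⟨l, hl, h⟩
    · rw [h0, MatchedPair.smul_bot (J := J)]
      exact Or.inl rfl
    · exact Or.inr ⟨m * l, (L p).smul_mem m _ hl, MatchedPair.eqOn_mul J m h⟩
  · have hq : ∀ q : Q, A p n (n • p.1 ⊓ q.1) := fun q => by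
      obtain ⟨s, hs, hsn⟩ := h q.1 q.2
      have hsn' : EqOn q.1 (show M from s) n := hsn
      rw [inf_comm, ← MatchedPair.inf_smul_eq J hsn']
      rcases A_mono p s _ (q.1 ⊓ (show M from s) • p.1) inf_le_right (hs p) with h0 | ⟨l, hl, h⟩
      · exact Or.inl h0
      · exact Or.inr ⟨l, hl, h.trans (hsn'.mono inf_le_left)⟩
    by_cases hne : (L p).carrier.Nonempty
    · obtain ⟨l₀, hl₀⟩ := hne
      have hq' : ∀ q : Q, ∃ l : M, l ∈ (L p).carrier ∧ EqOn (n • p.1 ⊓ q.1) l n := fun q => by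
        rcases hq q with h0 | h
        · exact ⟨l₀, hl₀, h0 ▸ eqOn_bot _ _⟩
        · exact h
      choose l hl hln using hq'
      obtain ⟨z, hz⟩ := exists_eqOn_smul (X := self J M) hQ (1 : M) l
      simp only [one_smul] at hz
      refine Or.inr ⟨z, (L p).local_mem Q hQ _ fun q hq => ⟨_, hl ⟨q, hq⟩, (hz ⟨q, hq⟩).symm⟩,
        eqOn_of_inf (X := self J M) hQ fun q hq => ?_⟩
      exact ((hz ⟨q, hq⟩).mono inf_le_right).trans (hln ⟨q, hq⟩)
    · -- if `L_p` is empty, then `n^* p` is disjoint from every block of `Q`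
      refine Or.inl (le_compl_self.1 ?_)
      refine le_trans le_top ((J.isPartition Q hQ).isLUB.2 fun q hq' => ?_)
      refine (le_compl_iff_disjoint_left.2 (disjoint_iff.2 ?_))
      rcases hq ⟨q, hq'⟩ with h0 | ⟨l, hl, -⟩
      · exact h0
      · exact absurd ⟨_, hl⟩ hne
  · rcases h p with h0 | ⟨l, hl, h⟩
    · exact absurd (hm.symm.trans h0) top_ne_bot
    · rw [hm] at h
      rwa [← eqOn_top h]
  · by_cases hpp : p' = p
    · subst hpp
      exact Or.inr ⟨m, h, EqOn.refl _ _⟩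
    · have hd := (J.isPartition P hP).disjoint _ p'.2 _ p.2 fun h => hpp (Subtype.ext h)
      refine Or.inl ?_
      rw [← inf_top_eq (m • p'.1), ← hm, ← MatchedPair.smul_inf (J := J), hd,
        MatchedPair.smul_bot (J := J)]

/-- Local equality of closed left ideals of `M`. -/
def Sub.idealLocalEquality (hM : ∀ b : B, b ≠ ⊥ → ∃ m : M, m • b = ⊤) :
    LocalEquality J M (Sub (self J M)) where
  rel := Sub.IdealEqOn
  refl _ _ _ _ := Iff.rfl
  symm _ _ _ h m hm := (h m hm).symm
  trans _ _ _ _ h h' m hm := (h m hm).trans (h' m hm)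
  mono _ _ _ _ hc h m hm := h m (top_le_iff.1 (hm ▸ MatchedPair.smul_mono J m hc))
  bot _ _ m hm := absurd (hm.symm.trans (MatchedPair.smul_bot (J := J) m)) top_ne_bot
  top _ _ h := Sub.ext (Set.ext fun m : M => h m (MatchedPair.smul_top (J := J) m))
  locality _ hP _ _ _ h := Sub.idealEqOn_of_inf hM hP h
  gluing _ hP x := Sub.exists_idealEqOn hP x
  smul_left b m n L h k hk := by
    have := MatchedPair.eqOn_mul J k h
    rw [hk] at this
    rw [Sub.mem_smul, Sub.mem_smul, eqOn_top this]
  smul_right b m L L' h k hk := by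
    rw [← mul_smul] at hk
    exact h (k * m) hk

section Classifier

variable (hM : ∀ b : B, b ≠ ⊥ → ∃ m : M, m • b = ⊤)

/-- The object of truth values: the closed left ideals of `M`. -/
noncomputable def omega : BMSet J M := (Sub.idealLocalEquality (J := J) hM).toBMSet

/-- The greatest left ideal. -/
def Sub.univ : Sub (self J M) := ⟨Set.univ, fun _ _ _ => trivial, fun _ _ _ _ => trivial⟩

/-- The truth value `true`. -/
noncomputable def truth : one J M ⟶ omega (J := J) hM :=
  point (X := omega hM) (Sub.univ : Sub (self J M)) fun _ => rfl

/-- The characteristic map of a closed subset. -/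
noncomputable def Sub.char {X : BMSet J M} (S : Sub X) : X ⟶ omega (J := J) hM :=
  homMk (Y := omega hM) S.residual
    (fun b x y h => (Sub.idealLocalEquality hM).toBMSet_eqOn.2 fun m hm => by
      have := eqOn_smul m h
      rw [hm] at this
      rw [Sub.mem_residual, Sub.mem_residual, eqOn_top this])
    (fun m x => Sub.ext (Set.ext fun n : M => by
      change n • m • x ∈ S.carrier ↔ (n * m) • x ∈ S.carrier
      rw [mul_smul]))

theorem Sub.residual_eq_univ {X : BMSet J M} {S : Sub X} {x : X.carrier} :
    S.residual x = Sub.univ ↔ x ∈ S.carrier := by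
  constructor
  · intro h
    have : (1 : M) ∈ (S.residual x).carrier := by rw [h]; trivial
    rwa [Sub.mem_residual, one_smul] at this
  · exact fun h => Sub.ext (Set.eq_univ_of_forall fun m => S.smul_mem m x h)

theorem isPullback_iff_of_truth {U X : BMSet J M} (i : U ⟶ X)
    (hi : Function.Injective (Hom.toFun i)) (χ : X ⟶ omega (J := J) hM) :
    IsPullback i ((isTerminalOne J M).from U) χ (truth hM) ↔
      ∀ x, Hom.toFun χ x = (Sub.univ : Sub (self J M)) ↔ x ∈ Set.range (Hom.toFun i) := by
  constructor
  · refine fun h x => ⟨fun hx => ?_, ?_⟩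
    · have w : orbit x ≫ χ = (isTerminalOne J M).from _ ≫ truth hM :=
        hom_ext (funext fun m : M => by
          change Hom.toFun χ (m • x) = (Sub.univ : Sub (self J M))
          rw [Hom.map_smul χ, hx]
          rfl)
      refine ⟨Hom.toFun (h.lift _ _ w) (1 : M), ?_⟩
      have := congrFun (congrArg Hom.toFun (h.lift_fst _ _ w)) (1 : M)
      refine Eq.trans this ?_
      exact one_smul M x
    · rintro ⟨y, rfl⟩
      exact congrFun (congrArg Hom.toFun h.w) y
  · intro h
    have hex : ∀ (s : PullbackCone χ (truth (J := J) hM)) (y : s.pt.carrier),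
        ∃ u, Hom.toFun i u = Hom.toFun s.fst y := fun s y =>
      (h _).1 (congrFun (congrArg Hom.toFun s.condition) y)
    choose g hg using hex
    refine ⟨⟨hom_ext (funext fun y => (h _).2 ⟨y, rfl⟩)⟩, ⟨PullbackCone.IsLimit.mk _
      (fun s => homMk (g s) (fun b y y' hy => eqOn_of_injective i hi ?_) fun m y => hi ?_)
      (fun s => hom_ext (funext fun y => hg s y)) (fun s => (isTerminalOne J M).hom_ext _ _)
      fun s m h₁ _ => hom_ext (funext fun y => hi ?_)⟩⟩
    · rw [hg, hg]
      exact Hom.map_eqOn _ hy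
    · rw [hg, Hom.map_smul i, hg, Hom.map_smul]
    · exact (congrFun (congrArg Hom.toFun h₁) y).trans (hg s y).symm

theorem hasSubobjectClassifier (hM : ∀ b : B, b ≠ ⊥ → ∃ m : M, m • b = ⊤) :
    HasSubobjectClassifier (BMSet J M) :=
  ⟨⟨Subobject.Classifier.mkOfTerminalΩ₀ (one J M) (isTerminalOne J M) (omega hM) (truth hM)
    (fun i _ => (Sub.range i).char hM)
    (fun i _ => (isPullback_iff_of_truth hM i (injective_of_mono i) _).2 fun _ =>
      Sub.residual_eq_univ)
    (fun {U X} i _ χ h => hom_ext (funext fun x => Sub.ext (Set.ext fun m : M => by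
      have h' := (isPullback_iff_of_truth hM i (injective_of_mono i) _).1 h
      change _ ↔ m • x ∈ Set.range (Hom.toFun i)
      rw [← h', Hom.map_smul χ]
      change m ∈ Sub.carrier (Hom.toFun χ x) ↔ Sub.residual (Hom.toFun χ x) m = Sub.univ
      exact Sub.residual_eq_univ.symm)))⟩⟩

theorem isTopos (hM : ∀ b : B, b ≠ ⊥ → ∃ m : M, m • b = ⊤) : IsTopos (BMSet J M) :=
  ⟨cartesianClosed J M, hasPullbacks, hasSubobjectClassifier hM⟩

end Classifier

end BMSet

section GrothendieckPairs

open BSet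

variable {B : Type u} [BooleanAlgebra B] {J : ZeroDimTopology B} {M : Type u} [Monoid M]
  [MulAction M B] [BSet B M] [BJSet J M]

/-! ### Stable ideals -/

namespace JIdeal

variable (M) in
/-- A `J`-closed ideal is stable when it is closed under the action of `M` on `B`. -/
def IsStable (I : JIdeal J) : Prop := ∀ (m : M), ∀ b ∈ I, m • b ∈ I

theorem mem_bot {b : B} : b ∈ (⊥ : JIdeal J) ↔ b = ⊥ :=
  ⟨fun h => le_bot_iff.1 ((bot_le : ⊥ ≤ principal J ⊥) h), fun h => h ▸ bot_mem _⟩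

theorem eq_top_of_top_mem {I : JIdeal J} (h : ⊤ ∈ I) : I = ⊤ :=
  top_le_iff.1 fun _ _ => I.lower le_top h

variable [MatchedPair J M]

variable (M) in
theorem isStable_bot : IsStable M (⊥ : JIdeal J) := by
  intro m b hb
  rw [mem_bot] at hb ⊢
  rw [hb, MatchedPair.smul_bot (J := J)]

theorem isOpenSieve_iff {I : JIdeal J} : (classifyingLocalic J M).IsOpenSieve I ↔ IsStable M I :=
  forall_congr' fun _ => pull_le

variable (J M) in
/-- The stable `J`-closed ideal generated by `b`. It needs no closing up: if `c` is covered by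
elements `p ≤ m_p^* b`, then gluing the `m_p` in `M` gives `m` with `c ≤ m^* b`. -/
def generated (b : B) : JIdeal J :=
  ofSet {c | ∃ m : M, c ≤ m • b} (fun _ _ h ⟨m, hm⟩ => ⟨m, h.trans hm⟩) ⟨1, bot_le⟩
    (by
      rintro c d ⟨m, hm⟩ ⟨n, hn⟩
      refine ⟨cond c m n, ?_⟩
      rw [MatchedPair.cond_smul (J := J), inf_eq_left.2 hm, sup_inf_left, sup_compl_eq_top,
        top_inf_eq]
      exact sup_le_sup_left hn c)
    (by
      classical
      rintro c P ⟨Q, hQ, hPQ, hl⟩ h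
      have : Nonempty M := ⟨1⟩
      obtain ⟨m, hm⟩ := BJSet.exists_eqOn (X := M) hQ
        fun p => if hp : p ∈ P then (h p hp).choose else 1
      refine ⟨m, hl.2 fun p hp => ?_⟩
      have hmp := hm p (hPQ hp)
      rw [dif_pos hp] at hmp
      have := MatchedPair.inf_smul_eq J hmp b
      rw [inf_eq_left.2 (h p hp).choose_spec] at this
      exact inf_eq_left.1 this)

theorem self_mem_generated (b : B) : b ∈ generated J M b := ⟨1, (one_smul M b).ge⟩

theorem isStable_generated (b : B) : IsStable M (generated J M b) := by
  rintro m c ⟨n, hn⟩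
  exact ⟨m * n, (MatchedPair.smul_mono J m hn).trans (mul_smul m n b).ge⟩

theorem exists_smul_eq_top {b : B} (h : ⊤ ∈ generated J M b) : ∃ m : M, m • b = ⊤ := by
  obtain ⟨m, hm⟩ := h
  exact ⟨m, top_le_iff.1 hm⟩

/-! ### The quotient of `B` by a stable ideal -/

/-- Congruence of elements of `B` modulo an ideal. -/
def congruence (I : JIdeal J) : Setoid B where
  r b c := symmDiff b c ∈ I
  iseqv :=
    { refl := fun b => by rw [symmDiff_self]; exact I.bot_mem
      symm := fun h => by rwa [symmDiff_comm]
      trans := fun h h' => I.lower (symmDiff_triangle _ _ _) (I.sup_mem h h') }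

theorem smul_symmDiff (J : ZeroDimTopology B) [BJSet J M] [MatchedPair J M] (m : M) (b c : B) :
    m • symmDiff b c = symmDiff (m • b) (m • c) := by
  simp only [symmDiff_def, sdiff_eq, MatchedPair.smul_sup (J := J), MatchedPair.smul_inf (J := J),
    MatchedPair.smul_compl J]

/-- The action of `M` on `B / I`. -/
@[reducible]
def quotientAction {I : JIdeal J} (hI : IsStable M I) : MulAction M (Quotient I.congruence) where
  smul m := Quotient.map (m • ·) fun b c h => by
    change symmDiff (m • b) (m • c) ∈ I
    rw [← smul_symmDiff J]
    exact hI m _ h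
  one_smul := by
    rintro ⟨b⟩
    exact congrArg (Quotient.mk _) (one_smul M b)
  mul_smul := by
    rintro m n ⟨b⟩
    exact congrArg (Quotient.mk _) (mul_smul m n b)

/-- Local equality in `B / I`: the classes of `b` and `c` are equal on `e` when `b` and `c` are
congruent below `e`. -/
def quotientLocalEquality {I : JIdeal J} (hI : IsStable M I) :
    letI := quotientAction hI
    BMSet.LocalEquality J M (Quotient I.congruence) :=
  letI := quotientAction hI
  { rel := fun e => Quotient.lift₂ (fun b c => e ⊓ symmDiff b c ∈ I) fun b c b' c' hb hc => by
      have key : ∀ {b c b' c' : B}, symmDiff b b' ∈ I → symmDiff c c' ∈ I →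
          e ⊓ symmDiff b' c' ∈ I → e ⊓ symmDiff b c ∈ I := fun {b c b' c'} hb hc h => by
        have hc' : symmDiff c' c ∈ I := by rwa [symmDiff_comm]
        refine I.lower (c := e ⊓ symmDiff b c) ?_ (I.sup_mem hb (I.sup_mem h hc'))
        refine (inf_le_inf_left e ((symmDiff_triangle b b' c).trans
          (sup_le_sup_left (symmDiff_triangle b' c' c) _))).trans ?_
        rw [inf_sup_left, inf_sup_left]
        exact sup_le_sup inf_le_right (sup_le_sup le_rfl inf_le_right)
      exact propext ⟨key (I.congruence.symm hb) (I.congruence.symm hc), key hb hc⟩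
    refl := by
      rintro e ⟨b⟩
      change e ⊓ symmDiff b b ∈ I
      rw [symmDiff_self, inf_bot_eq]
      exact I.bot_mem
    symm := by
      rintro e ⟨b⟩ ⟨c⟩ (h : e ⊓ symmDiff b c ∈ I)
      change e ⊓ symmDiff c b ∈ I
      rwa [symmDiff_comm]
    trans := by
      rintro e ⟨b⟩ ⟨c⟩ ⟨d⟩ (h : e ⊓ symmDiff b c ∈ I) (h' : e ⊓ symmDiff c d ∈ I)
      refine I.lower (c := e ⊓ symmDiff b d) ?_ (I.sup_mem h h')
      rw [← inf_sup_left]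
      exact inf_le_inf_left e (symmDiff_triangle _ _ _)
    mono := by
      rintro e e' ⟨b⟩ ⟨c⟩ hle h
      exact I.lower (inf_le_inf_right _ hle) h
    bot := by
      rintro ⟨b⟩ ⟨c⟩
      change ⊥ ⊓ symmDiff b c ∈ I
      rw [bot_inf_eq]
      exact I.bot_mem
    top := by
      rintro ⟨b⟩ ⟨c⟩ (h : ⊤ ⊓ symmDiff b c ∈ I)
      rw [top_inf_eq] at h
      exact Quotient.sound h
    locality := by
      rintro P hP e ⟨b⟩ ⟨c⟩ h
      refine I.mem_of_covers (ZeroDimTopology.inf_mem_covers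
        (ZeroDimTopology.mem_covers_top hP) le_top) ?_
      rintro _ ⟨⟨p, hp, rfl⟩, -⟩
      have : e ⊓ p ⊓ symmDiff b c ∈ I := h p hp
      change e ⊓ symmDiff b c ⊓ p ∈ I
      rwa [inf_right_comm]
    gluing := by
      classical
      intro P hP x
      obtain ⟨z, hz⟩ := ZeroDimTopology.exists_inf_eq hP
        fun p => if hp : p ∈ P then (x ⟨p, hp⟩).out else ⊥
      refine ⟨Quotient.mk _ z, fun p => ?_⟩
      have h := hz p.1 p.2
      rw [dif_pos p.2] at h
      rw [← Quotient.out_eq (x p)]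
      change p.1 ⊓ symmDiff z _ ∈ I
      rw [inf_symmDiff_distrib_left, h, symmDiff_self]
      exact I.bot_mem
    smul_left := by
      rintro b m n ⟨x⟩ h
      change b ⊓ symmDiff (m • x) (n • x) ∈ I
      rw [inf_symmDiff_distrib_left, MatchedPair.inf_smul_eq J h, symmDiff_self]
      exact I.bot_mem
    smul_right := by
      rintro b m ⟨x⟩ ⟨y⟩ h
      change m • b ⊓ symmDiff (m • x) (m • y) ∈ I
      rw [← smul_symmDiff J, ← MatchedPair.smul_inf (J := J)]
      exact hI m _ h }

/-- The `⟨B_J|M⟩`-set `B / I`. For `I = ⊥` it is the coproduct of two copies of the terminal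
`⟨B_J|M⟩`-set. -/
noncomputable def quotient {I : JIdeal J} (hI : IsStable M I) : BMSet J M :=
  letI := quotientAction hI
  (quotientLocalEquality hI).toBMSet

/-- The class of `b` in `B / I`. -/
def toQuotient {I : JIdeal J} (hI : IsStable M I) (b : B) : (quotient hI).carrier :=
  Quotient.mk I.congruence b

theorem toQuotient_eqOn {I : JIdeal J} {hI : IsStable M I} {e b c : B} :
    EqOn e (toQuotient hI b) (toQuotient hI c) ↔ e ⊓ symmDiff b c ∈ I :=
  letI := quotientAction hI
  (quotientLocalEquality hI).toBMSet_eqOn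

theorem toQuotient_eq {I : JIdeal J} {hI : IsStable M I} {b c : B} :
    toQuotient hI b = toQuotient hI c ↔ symmDiff b c ∈ I :=
  ⟨fun h => Quotient.exact (s := I.congruence) h, fun h => Quotient.sound (s := I.congruence) h⟩

theorem toQuotient_top_ne_bot {I : JIdeal J} {hI : IsStable M I} (h : ⊤ ∉ I) :
    toQuotient hI ⊤ ≠ toQuotient hI ⊥ := by
  rwa [ne_eq, toQuotient_eq, symmDiff_bot]

theorem toQuotient_eq_cond {I : JIdeal J} {hI : IsStable M I} (b : B) :
    cond b (toQuotient hI ⊤) (toQuotient hI ⊥) = toQuotient hI b := by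
  refine BMSet.cond_of_eqOn (toQuotient_eqOn.2 ?_) (toQuotient_eqOn.2 ?_)
  · rw [symmDiff_top, hnot_eq_compl, inf_compl_eq_bot]
    exact I.bot_mem
  · rw [symmDiff_bot, compl_inf_eq_bot]
    exact I.bot_mem

theorem smul_toQuotient_bot {I : JIdeal J} (hI : IsStable M I) (m : M) :
    m • toQuotient hI ⊥ = toQuotient hI ⊥ :=
  congrArg (toQuotient hI) (MatchedPair.smul_bot (J := J) m)

theorem smul_toQuotient_top {I : JIdeal J} (hI : IsStable M I) (m : M) :
    m • toQuotient hI ⊤ = toQuotient hI ⊤ :=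
  congrArg (toQuotient hI) (MatchedPair.smul_top (J := J) m)

end JIdeal

/-! ### Characteristic maps of the global elements of `B / I` -/

namespace BMSet

variable [MatchedPair J M] [Nontrivial B]

theorem mono_of_one {X : BMSet J M} (f : one J M ⟶ X) : Mono f :=
  (isTerminalOne J M).mono_from f

variable (J M) in
/-- The inclusion of the empty subset in the terminal object. -/
noncomputable def emptyToOne : (Sub.empty (one J M)).toBMSet ⟶ one J M := (Sub.empty (one J M)).ι

instance : Mono (emptyToOne J M) :=
  mono_of_injective _ fun x _ _ => absurd x.2 (Set.notMem_empty _)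

/-- If two global elements `e, e'` are different, then the characteristic map of `e` sends `e'` to
the truth value `false`, which classifies the empty subset of the terminal object. -/
theorem comp_χ_eq_false (c : Subobject.Classifier (BMSet J M)) {X : BMSet J M} (e e' : one J M ⟶ X)
    [Mono e] (h : e ≠ e') : e' ≫ c.χ e = c.χ (emptyToOne J M) := by
  have hE : ∀ {Y : BMSet J M} (f g : Y ⟶ one J M), f ≫ e' = g ≫ e → ∀ y : Y.carrier, False :=
    fun f g hfg y => h (hom_ext (funext fun x => by
      rw [one_eq x (Hom.toFun g y)]
      refine (congrFun (congrArg Hom.toFun hfg) y).symm.trans ?_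
      exact congrArg (Hom.toFun e') (one_eq _ _)))
  refine c.uniq (χ₀' := emptyToOne J M ≫ c.χ₀ _) _ (IsPullback.paste_vert ?_ (c.isPullback e))
  exact ⟨⟨hom_ext (funext fun y => absurd y.2 (Set.notMem_empty _))⟩, ⟨PullbackCone.IsLimit.mk _
    (fun s => Sub.lift _ s.fst fun y => hE _ _ s.condition y)
    (fun s => (isTerminalOne J M).hom_ext _ _) (fun s => (isTerminalOne J M).hom_ext _ _)
    fun s m _ _ => Sub.hom_ext_ι _ ((isTerminalOne J M).hom_ext _ _)⟩⟩

/-- The element `0` of `B / I`, as a global element. -/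
noncomputable def botPoint {I : JIdeal J} (hI : JIdeal.IsStable M I) :
    one J M ⟶ JIdeal.quotient hI :=
  point (JIdeal.toQuotient hI ⊥) (JIdeal.smul_toQuotient_bot hI)

/-- The element `1` of `B / I`, as a global element. -/
noncomputable def topPoint {I : JIdeal J} (hI : JIdeal.IsStable M I) :
    one J M ⟶ JIdeal.quotient hI :=
  point (JIdeal.toQuotient hI ⊤) (JIdeal.smul_toQuotient_top hI)

instance {I : JIdeal J} (hI : JIdeal.IsStable M I) : Mono (botPoint hI) := mono_of_one _

/-- For a proper stable ideal `I`, the characteristic map of `0` in `B / I` sends `b` to the truth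
value "`false` if `b`, else `true`", as it sends `0` to `true` and `1` to `false`. -/
theorem χ_botPoint_apply (c : Subobject.Classifier (BMSet J M)) {I : JIdeal J}
    (hI : JIdeal.IsStable M I) (h : ⊤ ∉ I) (b : B) :
    Hom.toFun (c.χ (botPoint hI)) (JIdeal.toQuotient hI b) =
      cond b (Hom.toFun (c.χ (emptyToOne J M)) (pt J M))
        (Hom.toFun (c.χ₀ _ ≫ c.truth) (pt J M)) := by
  have h₁ : topPoint hI ≫ c.χ (botPoint hI) = c.χ (emptyToOne J M) :=
    comp_χ_eq_false c _ _ fun h' =>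
      JIdeal.toQuotient_top_ne_bot h (congrFun (congrArg Hom.toFun h') (pt J M)).symm
  have h₂ := (c.isPullback (botPoint hI)).w
  rw [← JIdeal.toQuotient_eq_cond, Hom.map_cond (c.χ (botPoint hI)), ← h₁, ← h₂]
  rfl

/-- If there is a subobject classifier, a non-zero `b` generates the improper stable ideal `I`.
Otherwise the characteristic maps of `0` in `B` and in `B / I` take the same value at `b`; as `b`
vanishes in `B / I`, this value is `true`, so that `b` is zero. -/
theorem exists_smul_eq_top_of_classifier (c : Subobject.Classifier (BMSet J M)) (b : B)
    (hb : b ≠ ⊥) : ∃ m : M, m • b = ⊤ := by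
  refine JIdeal.exists_smul_eq_top (J := J) ?_
  by_contra h
  have hI := JIdeal.isStable_generated (J := J) (M := M) b
  have h0 := JIdeal.isStable_bot (J := J) M
  have htop : ⊤ ∉ (⊥ : JIdeal J) := fun h => top_ne_bot (JIdeal.mem_bot.1 h)
  have hbI : JIdeal.toQuotient hI b = JIdeal.toQuotient hI ⊥ := by
    rw [JIdeal.toQuotient_eq, symmDiff_bot]
    exact JIdeal.self_mem_generated b
  have hχ : Hom.toFun (c.χ (botPoint h0)) (JIdeal.toQuotient h0 b) =
      Hom.toFun (c.χ₀ _ ≫ c.truth) (pt J M) := by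
    rw [χ_botPoint_apply c h0 htop, ← χ_botPoint_apply c hI h, hbI]
    exact congrFun (congrArg Hom.toFun (c.isPullback (botPoint hI)).w) (pt J M)
  have w : orbit (JIdeal.toQuotient h0 b) ≫ c.χ (botPoint h0) =
      ((isTerminalOne J M).from _ ≫ c.χ₀ _) ≫ c.truth :=
    hom_ext (funext fun m : M => by
      change Hom.toFun (c.χ (botPoint h0)) (m • JIdeal.toQuotient h0 b) = _
      rw [Hom.map_smul (c.χ (botPoint h0)), hχ, ← Hom.map_smul (c.χ₀ _ ≫ c.truth)]
      exact congrArg (Hom.toFun (c.χ₀ _ ≫ c.truth)) (one_eq _ _))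
  have h' := congrFun (congrArg Hom.toFun ((c.isPullback (botPoint h0)).lift_fst _ _ w)) (1 : M)
  have h'' : JIdeal.toQuotient h0 ⊥ = (1 : M) • JIdeal.toQuotient h0 b := h'
  rw [one_smul, JIdeal.toQuotient_eq, bot_symmDiff, JIdeal.mem_bot] at h''
  exact hb h''

end BMSet

/-! ### Restriction maps and global sections of sheaves -/

namespace BMPresheaf

variable (X : BMPresheaf B M)

/-- The restriction map `b ∧ (-) : X(c) → X(b)` for `b ≤ c`. -/
def res {b c : NonBot B} (h : b.1 ≤ c.1) : X.sec c → X.sec b := X.meet b.1 (inf_eq_left.2 h)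

variable {X}

theorem meet_eq_res {b : B} {c d : NonBot B} (h : b ⊓ c.1 = d.1) (x : X.sec c) :
    X.meet b h x = X.res (h ▸ inf_le_right) x := by
  have hb : b ⊓ c.1 ⊓ c.1 = d.1 := by rw [inf_assoc, inf_idem, h]
  have h₁ := X.meet_meet b c.1 (inf_idem c.1) h hb x
  rw [X.meet_self] at h₁
  rw [← h₁, res]
  congr 1

theorem res_self {b : NonBot B} (h : b.1 ≤ b.1) (x : X.sec b) : X.res h x = x := X.meet_self _ x

theorem res_res {a b c : NonBot B} (h : b.1 ≤ c.1) (h' : a.1 ≤ b.1) (x : X.sec c) :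
    X.res h' (X.res h x) = X.res (h'.trans h) x := by
  have := X.meet_meet a.1 b.1 (inf_eq_left.2 h) (inf_eq_left.2 h')
    (by rw [inf_assoc, inf_eq_left.2 h, inf_eq_left.2 h']) x
  rw [meet_eq_res] at this
  exact this.symm

theorem act_res (m : M) {b c d e : NonBot B} (h : b.1 ≤ c.1) (hb : m • b.1 = d.1)
    (hc : m • c.1 = e.1) (hde : d.1 ≤ e.1) (x : X.sec c) :
    X.act m hb (X.res h x) = X.res hde (X.act m hc x) := by
  have := X.act_meet m b.1 (inf_eq_left.2 h) hb hc (by rw [hb, inf_eq_left.2 hde]) x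
  exact this.trans (meet_eq_res _ _)

theorem res_act_of_eqOn {b c d e : NonBot B} {m n : M} (h : EqOn b.1 m n) (hm : m • c.1 = d.1)
    (hn : n • c.1 = e.1) (hd : b.1 ≤ d.1) (he : b.1 ≤ e.1) (x : X.sec c) :
    X.res hd (X.act m hm x) = X.res he (X.act n hn x) :=
  X.meet_act_of_eqOn b.1 m n h hm hn _ _ x

theorem le_of_mem_covers {c : NonBot B} {P : Set B} (hP : P ∈ J.covers c.1) {b : NonBot B}
    (hb : b.1 ∈ P) : b.1 ≤ c.1 := inf_eq_left.1 (ZeroDimTopology.inf_eq_of_mem_covers hP hb)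

theorem IsSheaf.separated (hX : IsSheaf J M X) {c : NonBot B} {P : Set B}
    (hP : P ∈ J.covers c.1) {x y : X.sec c}
    (h : ∀ (b : NonBot B) (hb : b.1 ∈ P),
      X.res (le_of_mem_covers hP hb) x = X.res (le_of_mem_covers hP hb) y) : x = y := by
  obtain ⟨g, -, hg⟩ := hX c P hP
  rw [← hg x, ← hg y]
  congr 1
  funext b hb
  exact h b hb

theorem IsSheaf.exists_res_eq (hX : IsSheaf J M X) {c : NonBot B} {P : Set B}
    (hP : P ∈ J.covers c.1) (x : ∀ b : NonBot B, b.1 ∈ P → X.sec b) :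
    ∃ z : X.sec c, ∀ (b : NonBot B) (hb : b.1 ∈ P), X.res (le_of_mem_covers hP hb) z = x b hb := by
  obtain ⟨g, hg, -⟩ := hX c P hP
  exact ⟨g x, hg x⟩

/-- A homomorphism of presheaves with bijective components is an isomorphism. -/
noncomputable def isoOfBijective {X Y : BMPresheaf B M} (f : X ⟶ Y)
    (hf : ∀ c, Function.Bijective (Hom.app f c)) : X ≅ Y where
  hom := f
  inv :=
    { app := fun c => (Equiv.ofBijective _ (hf c)).symm
      map_act := fun m c d h y => (hf d).1 (by
        rw [Hom.map_act f]
        simp only [Equiv.ofBijective_apply_symm_apply])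
      map_meet := fun b c d h y => (hf d).1 (by
        rw [Hom.map_meet f]
        simp only [Equiv.ofBijective_apply_symm_apply]) }
  hom_inv_id := hom_ext fun c => funext fun x =>
    (Equiv.ofBijective _ (hf c)).symm_apply_apply x
  inv_hom_id := hom_ext fun c => funext fun y => (Equiv.ofBijective _ (hf c)).apply_symm_apply y

section GlobalSections

variable [Nontrivial B]

variable (B) in
/-- The greatest element, as a non-zero element. -/
abbrev topNonBot : NonBot B := ⟨⊤, top_ne_bot⟩

variable [MatchedPair J M]

variable (J X) in
/-- The action of `M` on the global sections. -/
@[reducible]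
def globalAction : MulAction M (X.sec (topNonBot B)) where
  smul m := X.act m (MatchedPair.smul_top (J := J) m)
  one_smul x := X.one_act _ x
  mul_smul m n x := X.mul_act m n _ _ _ x

/-- Local equality of global sections of a sheaf. -/
def IsSheaf.localEquality (hX : IsSheaf J M X) :
    letI := globalAction J X
    BMSet.LocalEquality J M (X.sec (topNonBot B)) :=
  letI := globalAction J X
  { rel := fun b x y => ∀ h : b ≠ ⊥,
      X.res (b := ⟨b, h⟩) le_top x = X.res (b := ⟨b, h⟩) le_top y
    refl := fun _ _ _ => rfl
    symm := fun _ _ _ h h0 => (h h0).symm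
    trans := fun _ _ _ _ h h' h0 => (h h0).trans (h' h0)
    mono := fun b c x y hc h h0 => by
      have hb : b ≠ ⊥ := fun hb => h0 (le_bot_iff.1 (hb ▸ hc))
      have := congrArg (X.res (b := ⟨c, h0⟩) (c := ⟨b, hb⟩) hc) (h hb)
      rwa [res_res, res_res] at this
    bot := fun _ _ h0 => absurd rfl h0
    top := fun x y h => by
      have := h top_ne_bot
      rwa [res_self, res_self] at this
    locality := fun P hP b x y h h0 => by
      refine hX.separated (ZeroDimTopology.inf_mem_covers
        (ZeroDimTopology.mem_covers_top hP) (le_top (a := b))) ?_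
      rintro ⟨d, hd⟩ ⟨⟨p, hp, hpd⟩, -⟩
      obtain rfl : b ⊓ p = d := hpd
      rw [res_res, res_res]
      exact h p hp hd
    gluing := fun P hP x => by
      obtain ⟨z, hz⟩ := hX.exists_res_eq (c := topNonBot B) (ZeroDimTopology.mem_covers_top hP)
        fun b hb => X.res le_top (x ⟨b.1, hb⟩)
      exact ⟨z, fun p h0 => hz ⟨p.1, h0⟩ p.2⟩
    smul_left := fun b m n x h h0 => res_act_of_eqOn (b := ⟨b, h0⟩) h _ _ _ _ x
    smul_right := fun b m x y h h0 => by
      have hb : b ≠ ⊥ := by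
        rintro rfl
        exact h0 (MatchedPair.smul_bot (J := J) m)
      have := congrArg (X.act m (c := ⟨b, hb⟩) (d := ⟨m • b, h0⟩) rfl) (h hb)
      rwa [act_res (e := topNonBot B) (hc := MatchedPair.smul_top (J := J) m) (hde := le_top),
        act_res (e := topNonBot B) (hc := MatchedPair.smul_top (J := J) m) (hde := le_top)]
          at this }

/-- The `⟨B_J|M⟩`-set of global sections of a sheaf. -/
noncomputable def IsSheaf.globalSections (hX : IsSheaf J M X) : BMSet J M :=
  letI := globalAction J X
  hX.localEquality.toBMSet

theorem IsSheaf.globalSections_eqOn (hX : IsSheaf J M X) {b : NonBot B}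
    {x y : X.sec (topNonBot B)} :
    EqOn (X := hX.globalSections.carrier) b.1 x y ↔
      X.res (b := b) le_top x = X.res (b := b) le_top y :=
  letI := globalAction J X
  hX.localEquality.toBMSet_eqOn.trans ⟨fun h => h b.2, fun h _ => h⟩

/-- The canonical homomorphism from `B ∧ X(1)` to `X`. -/
noncomputable def IsSheaf.fromWedge (hX : IsSheaf J M X) : wedgePresheaf hX.globalSections ⟶ X where
  app c := Quotient.lift (fun x : X.sec (topNonBot B) => X.res le_top x)
    fun _ _ h => hX.globalSections_eqOn.1 h
  map_act := by
    rintro m c d h ⟨x⟩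
    exact (act_res m le_top h (MatchedPair.smul_top (J := J) m) le_top x).symm
  map_meet := by
    rintro b c d h ⟨x⟩
    exact ((meet_eq_res h _).trans (res_res _ _ (show X.sec (topNonBot B) from x))).symm

/-- If every non-zero element of `B` is moved to `1` by some element of `M`, then every local
section extends to a global one: act on it to get some global section, and use that one on the
complement. -/
theorem IsSheaf.res_surjective (hM : ∀ b : B, b ≠ ⊥ → ∃ m : M, m • b = ⊤)
    (hX : IsSheaf J M X) (c : NonBot B) :
    Function.Surjective (X.res (b := c) (c := topNonBot B) le_top) := by
  classical
  intro x
  obtain ⟨m, hm⟩ := hM c.1 c.2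
  have hP : ({c.1, c.1ᶜ} \ {⊥} : Set B) ∈ J.covers (topNonBot B).1 :=
    ZeroDimTopology.mem_covers_top (J.pair_compl_mem_parts c.1)
  obtain ⟨z, hz⟩ := hX.exists_res_eq hP fun b _ =>
    if h : c = b then h ▸ x else X.res le_top (X.act (d := topNonBot B) m hm x)
  refine ⟨z, ?_⟩
  have := hz c ⟨by simp, c.2⟩
  rwa [dif_pos rfl] at this

theorem IsSheaf.fromWedge_bijective (hM : ∀ b : B, b ≠ ⊥ → ∃ m : M, m • b = ⊤)
    (hX : IsSheaf J M X) (c : NonBot B) : Function.Bijective (Hom.app hX.fromWedge c) := by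
  constructor
  · rintro ⟨x⟩ ⟨y⟩ h
    exact Quotient.sound (hX.globalSections_eqOn.2 h)
  · intro x
    obtain ⟨y, hy⟩ := hX.res_surjective hM c x
    exact ⟨Quotient.mk _ y, hy⟩

end GlobalSections

end BMPresheaf

/-! ### The functor from sets to sheaves -/

section Wedge

variable [MatchedPair J M] [Nontrivial B]

open BMPresheaf

instance : (wedge J M).Faithful where
  map_injective {X Y f g} h := BMSet.hom_ext (funext fun x => by
    have h' : Hom.app ((wedge J M).map f).hom (topNonBot B) (Quotient.mk _ x) =
      Hom.app ((wedge J M).map g).hom (topNonBot B) (Quotient.mk _ x) := by rw [h]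
    exact eqOn_top (Quotient.exact h'))

instance : (wedge J M).Full where
  map_surjective {X Y} φ := by
    have hex : ∀ x : X.carrier, ∃ y : Y.carrier, Hom.app φ.hom (topNonBot B)
        (Quotient.mk (setoid X.carrier ⊤) x) = Quotient.mk (setoid Y.carrier ⊤) y :=
      fun x => (Quotient.exists_rep _).imp fun _ h => h.symm
    choose f hf using hex
    have hf' : ∀ (c : NonBot B) (x : X.carrier), Hom.app φ.hom c
        (Quotient.mk (setoid X.carrier c.1) x) = Quotient.mk (setoid Y.carrier c.1) (f x) := by
      intro c x
      have h := Hom.map_meet φ.hom c.1 (c := topNonBot B) (d := c) (inf_top_eq _)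
        (Quotient.mk (setoid X.carrier ⊤) x)
      rw [hf] at h
      exact h
    refine ⟨BMSet.homMk f (fun b x y h => ?_) fun m x => ?_, ?_⟩
    · by_cases hb : b = ⊥
      · exact hb ▸ eqOn_bot _ _
      · have h' : Quotient.mk (setoid X.carrier b) x = Quotient.mk _ y := Quotient.sound h
        refine Quotient.exact (s := setoid Y.carrier b) ?_
        rw [← hf' ⟨b, hb⟩, ← hf' ⟨b, hb⟩]
        exact congrArg _ h'
    · have h := Hom.map_act φ.hom m (c := topNonBot B) (d := topNonBot B)
        (MatchedPair.smul_top (J := J) m) (Quotient.mk (setoid X.carrier ⊤) x)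
      rw [hf] at h
      refine eqOn_top (B := B) (Quotient.exact (s := setoid Y.carrier ⊤) ?_)
      exact (hf _).symm.trans h
    · apply ObjectProperty.hom_ext
      apply BMPresheaf.hom_ext
      rintro c
      funext x
      induction x using Quotient.inductionOn with | h x => exact (hf' c x).symm

theorem wedge_isEquivalence (hM : ∀ b : B, b ≠ ⊥ → ∃ m : M, m • b = ⊤) :
    (wedge J M).IsEquivalence where
  essSurj := ⟨fun X => ⟨X.property.globalSections,
    ⟨(BMPresheaf.IsSheaf J M).isoMk
      (isoOfBijective X.property.fromWedge (X.property.fromWedge_bijective hM))⟩⟩⟩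

/-! ### Subterminal sheaves -/

variable (J M) in
/-- The subterminal sheaf of a stable `J`-closed ideal: it has a section on `c` when `c ∈ I`. -/
def subterminal {I : JIdeal J} (hI : JIdeal.IsStable M I) : BMShv J M where
  obj :=
    { sec := fun c => {_x : PUnit.{u + 1} // c.1 ∈ I}
      act := fun m c d h x => ⟨x.1, h ▸ hI m c.1 x.2⟩
      meet := fun b c d h x => ⟨x.1, h ▸ I.lower inf_le_right x.2⟩
      meet_self := by intros; rfl
      meet_meet := by intros; rfl
      one_act := by intros; rfl
      mul_act := by intros; rfl
      act_meet := by intros; rfl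
      meet_act_of_eqOn := by intros; rfl }
  property := fun c P hP => ⟨fun x => ⟨PUnit.unit, I.mem_of_covers hP fun b hb =>
    (x ⟨b, ZeroDimTopology.ne_bot_of_mem_covers hP hb⟩ hb).2⟩, fun _ _ _ => rfl, fun _ => rfl⟩

/-- The homomorphism from the terminal sheaf to `B ∧ X` given by an `M`-invariant element. -/
def wedgePoint {X : BMSet J M} (e : X.carrier) (he : ∀ m : M, m • e = e) :
    BMShv.one J M ⟶ (wedge J M).obj X :=
  ObjectProperty.homMk
    { app := fun _ _ => Quotient.mk _ e
      map_act := fun m _ _ _ _ => congrArg (Quotient.mk _) (he m).symm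
      map_meet := fun _ _ _ _ _ => rfl }

/-- In a two-valued category of sheaves, the subterminal sheaf of a non-zero stable ideal `I` is
well-supported. As the global elements `0` and `1` of `B / I` agree on it, they are equal. -/
theorem top_mem_of_isTwoValued (h : IsTwoValued (BMShv J M)) {I : JIdeal J}
    (hI : JIdeal.IsStable M I) {b : B} (hb : b ≠ ⊥) (hbI : b ∈ I) : ⊤ ∈ I := by
  have hU : twoValuedCollapse (BMShv J M) (subterminal J M hI) := by
    rw [show twoValuedCollapse (BMShv J M) = ⊤ from h]
    trivial
  rcases hU with ⟨⟨h0⟩⟩ | hepi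
  · have x := Hom.app (h0.to (subterminal J M (JIdeal.isStable_bot M))).hom ⟨b, hb⟩
      ⟨PUnit.unit, hbI⟩
    exact absurd (JIdeal.mem_bot.1 x.2) hb
  · let p : ⊤_ (BMShv J M) ⟶ BMShv.one J M := ObjectProperty.homMk
      ⟨fun _ _ => PUnit.unit, fun _ _ _ _ _ => rfl, fun _ _ _ _ _ => rfl⟩
    have hp : terminal.from (BMShv.one J M) ≫ p = 𝟙 _ := rfl
    have key : p ≫ wedgePoint _ (JIdeal.smul_toQuotient_bot hI) =
        p ≫ wedgePoint _ (JIdeal.smul_toQuotient_top hI) := by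
      rw [← cancel_epi (terminal.from (subterminal J M hI))]
      apply ObjectProperty.hom_ext
      apply BMPresheaf.hom_ext
      intro c
      funext x
      refine Quotient.sound (JIdeal.toQuotient_eqOn.2 ?_)
      rw [bot_symmDiff, inf_top_eq]
      exact x.2
    have h' := congrArg (terminal.from (BMShv.one J M) ≫ ·) key
    simp only [← Category.assoc, hp, Category.id_comp] at h'
    have h'' : Hom.app (wedgePoint _ (JIdeal.smul_toQuotient_bot hI)).hom (topNonBot B) PUnit.unit =
      Hom.app (wedgePoint _ (JIdeal.smul_toQuotient_top hI)).hom (topNonBot B) PUnit.unit := by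
      rw [h']
    have h₃ := JIdeal.toQuotient_eqOn.1 (Quotient.exact h'')
    rwa [bot_symmDiff, inf_top_eq] at h₃

theorem isTwoValued (hM : ∀ b : B, b ≠ ⊥ → ∃ m : M, m • b = ⊤) : IsTwoValued (BMShv J M) := by
  refine funext fun X => eq_true ?_
  by_cases hX : ∃ c, Nonempty (X.obj.sec c)
  · obtain ⟨c, ⟨x⟩⟩ := hX
    obtain ⟨y, -⟩ := X.property.res_surjective hM c x
    refine Or.inr ⟨fun {Z} f g h => ?_⟩
    have hone : ∀ (d : NonBot B) (s t : (⊤_ (BMShv J M)).obj.sec d), s = t := by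
      intro d s t
      let p : ⊤_ (BMShv J M) ⟶ BMShv.one J M := ObjectProperty.homMk
        ⟨fun _ _ => PUnit.unit, fun _ _ _ _ _ => rfl, fun _ _ _ _ _ => rfl⟩
      have hp : p ≫ terminal.from (BMShv.one J M) = 𝟙 _ := terminal.hom_ext _ _
      have hp' : ∀ s, Hom.app (p ≫ terminal.from (BMShv.one J M)).hom d s = s := by
        rw [hp]
        exact fun _ => rfl
      rw [← hp' s, ← hp' t]
      rfl
    apply ObjectProperty.hom_ext
    apply BMPresheaf.hom_ext
    intro d
    funext s
    rw [hone d s (Hom.app (terminal.from X).hom d (X.obj.res le_top y))]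
    exact congrFun (congrArg (fun k => Hom.app (InducedCategory.Hom.hom k) d) h) _
  · have he : ∀ c, X.obj.sec c → False := fun c x => hX ⟨c, ⟨x⟩⟩
    exact Or.inl ⟨IsInitial.ofUniqueHom
      (fun Y => ObjectProperty.homMk ⟨fun c x => (he c x).elim, fun _ _ _ _ x => (he _ x).elim,
        fun _ _ _ _ x => (he _ x).elim⟩)
      fun Y f => by
        apply ObjectProperty.hom_ext
        apply BMPresheaf.hom_ext
        intro d
        funext s
        exact (he d s).elim⟩

/-- An equivalence `B ∧ (-)` presents the subterminal sheaf of the stable ideal generated by `b` by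
a set, which is non-empty as the sheaf has a section on `b`; so the sheaf has a global section. -/
theorem exists_smul_eq_top_of_wedge (h : (wedge J M).IsEquivalence) (b : B) (hb : b ≠ ⊥) :
    ∃ m : M, m • b = ⊤ := by
  have hI := JIdeal.isStable_generated (J := J) (M := M) b
  obtain ⟨X, ⟨e⟩⟩ := h.essSurj.mem_essImage (subterminal J M hI)
  obtain ⟨x, -⟩ := Quotient.exists_rep (Hom.app e.inv.hom ⟨b, hb⟩
    ⟨PUnit.unit, JIdeal.self_mem_generated b⟩)
  exact JIdeal.exists_smul_eq_top (J := J)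
    (Hom.app e.hom.hom (topNonBot B) (Quotient.mk _ x)).2

end Wedge

/-! ### The classifying categories -/

section Classifying

variable [MatchedPair J M]

theorem classifyingLocalic_isMinimal (hM : ∀ b : B, b ≠ ⊥ → ∃ m : M, m • b = ⊤) :
    (classifyingLocalic J M).IsMinimal := by
  intro (I : JIdeal J) hI
  have hI' : JIdeal.IsStable M I := JIdeal.isOpenSieve_iff.1 hI
  by_cases h : ∃ b ∈ I, b ≠ ⊥
  · obtain ⟨b, hb, h0⟩ := h
    obtain ⟨m, hm⟩ := hM b h0
    exact Or.inr (JIdeal.eq_top_of_top_mem (hm ▸ hI' m b hb))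
  · push Not at h
    exact Or.inl (le_bot_iff.1 fun b hb => JIdeal.mem_bot.2 (h b hb))

theorem exists_smul_eq_top_of_localic (h : (classifyingLocalic J M).IsMinimal) (b : B)
    (hb : b ≠ ⊥) : ∃ m : M, m • b = ⊤ := by
  refine JIdeal.exists_smul_eq_top (J := J) ?_
  have hmem := JIdeal.self_mem_generated (J := J) (M := M) b
  rcases h (JIdeal.generated J M b) (JIdeal.isOpenSieve_iff.2 (JIdeal.isStable_generated b)) with
    h | h
  · have h' : JIdeal.generated J M b = ⊥ := h
    rw [h'] at hmem
    exact absurd (JIdeal.mem_bot.1 hmem) hb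
  · have h' : JIdeal.generated J M b = ⊤ := h
    rw [h']
    exact JIdeal.mem_top

namespace BoolUltrafilter

/-- The ultrafilter complementary to a prime ideal. -/
def ofIsPrime (I : Order.Ideal B) (hI : I.IsPrime) : BoolUltrafilter B where
  carrier := {b | b ∉ I}
  top_mem := fun h => hI.ne_top (Order.Ideal.top_of_top_mem h)
  inf_mem b c hb hc h := (hI.mem_or_mem h).elim hb hc
  upper b c h hb hc := hb (I.lower h hc)
  compl_mem_iff b := by
    change bᶜ ∉ I ↔ ¬ b ∉ I
    refine ⟨fun h h' => hI.mem_or_compl_mem.elim h' h, fun h hc => h fun hb => ?_⟩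
    have := Order.Ideal.sup_mem hb hc
    rw [sup_compl_eq_top] at this
    exact hI.ne_top (Order.Ideal.top_of_top_mem this)

/-- A proper ideal misses some ultrafilter. -/
theorem exists_disjoint (I : Order.Ideal B) (hI : ⊤ ∉ I) :
    ∃ U : BoolUltrafilter B, ∀ b ∈ I, b ∉ U.carrier := by
  obtain ⟨K, hK, hIK, -⟩ := DistribLattice.prime_ideal_of_disjoint_filter_ideal
    (F := Order.PFilter.principal (⊤ : B)) (I := I) (by
      rw [Set.disjoint_left]
      intro b hb hbI
      have : b = ⊤ := top_le_iff.1 hb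
      exact hI (this ▸ hbI))
  exact ⟨ofIsPrime K hK, fun b hb h => h (hIK hb)⟩

theorem nonempty_basic {b : B} (hb : b ≠ ⊥) : ∃ U : BoolUltrafilter B, b ∈ U.carrier := by
  obtain ⟨U, hU⟩ := exists_disjoint (Order.Ideal.principal bᶜ) (by
    intro h
    exact hb (compl_eq_top.1 (top_le_iff.1 h)))
  refine ⟨U, ?_⟩
  have := hU bᶜ le_rfl
  rwa [U.compl_mem_iff, not_not] at this

theorem bot_notMem (U : BoolUltrafilter B) : ⊥ ∉ U.carrier := by
  rw [← U.compl_mem_iff, compl_bot]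
  exact U.top_mem

/-- The sets of ultrafilters containing a given element form a basis. -/
theorem exists_basic_subset {S : Set (BoolUltrafilter B)} (hS : IsOpen S) {U : BoolUltrafilter B}
    (hU : U ∈ S) : ∃ b ∈ U.carrier, ∀ V : BoolUltrafilter B, b ∈ V.carrier → V ∈ S := by
  induction hS with
  | basic s hs =>
    obtain ⟨b, rfl⟩ := hs
    exact ⟨b, hU, fun _ h => h⟩
  | univ => exact ⟨⊤, U.top_mem, fun _ _ => trivial⟩
  | inter s t _ _ hs ht =>
    obtain ⟨b, hb, hbs⟩ := hs hU.1
    obtain ⟨c, hc, hct⟩ := ht hU.2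
    exact ⟨b ⊓ c, U.inf_mem _ _ hb hc, fun V hV =>
      ⟨hbs V (V.upper _ _ inf_le_left hV), hct V (V.upper _ _ inf_le_right hV)⟩⟩
  | sUnion T _ ih =>
    obtain ⟨s, hs, hUs⟩ := hU
    obtain ⟨b, hb, h⟩ := ih s hs hUs
    exact ⟨b, hb, fun V hV => ⟨s, hs, h V hV⟩⟩

end BoolUltrafilter

open BoolUltrafilter

theorem classifyingTopological_isMinimal (hM : ∀ b : B, b ≠ ⊥ → ∃ m : M, m • b = ⊤) :
    (classifyingTopological M J).IsMinimal := by
  rintro (S : Set (BoolUltrafilter B)) ⟨hS, hsieve⟩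
  rcases S.eq_empty_or_nonempty with h | ⟨U, hU⟩
  · exact Or.inl h
  refine Or.inr (Set.eq_univ_of_forall fun V => ?_)
  obtain ⟨b, hb, hbS⟩ := exists_basic_subset hS hU
  obtain ⟨m, hm⟩ := hM b fun h => U.bot_notMem (h ▸ hb)
  refine hsieve (GermArr.mk V m) (hbS (push J m V) ?_)
  change m • b ∈ V.carrier
  rw [hm]
  exact V.top_mem

/-- The open sieve of those `U` that contain some `m^* b` is the whole space. Thus no ultrafilter
misses the ideal generated by the `m^* b`, which is therefore improper. -/
theorem exists_smul_eq_top_of_topological (h : (classifyingTopological M J).IsMinimal) (b : B)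
    (hb : b ≠ ⊥) : ∃ m : M, m • b = ⊤ := by
  refine JIdeal.exists_smul_eq_top (J := J) ?_
  by_contra htop
  obtain ⟨V, hV⟩ := BoolUltrafilter.exists_disjoint (JIdeal.generated J M b).toIdeal htop
  let S : Set (BoolUltrafilter B) := ⋃ m : M, {U | m • b ∈ U.carrier}
  have hS : (classifyingTopological M J).IsOpenSieve S := by
    refine ⟨isOpen_iUnion fun m => BoolUltrafilter.isOpen_basic _, fun (f : GermArr B M) hf => ?_⟩
    obtain ⟨n, hn⟩ := f.exists_eq
    obtain ⟨m, hm⟩ := Set.mem_iUnion.1 hf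
    refine Set.mem_iUnion.2 ⟨n * m, ?_⟩
    change m • b ∈ (GermArr.tgt J f).carrier at hm
    rw [hn, GermArr.tgt_mk] at hm
    change (n * m) • b ∈ f.1.carrier
    rw [mul_smul]
    exact hm
  rcases h S hS with h | h
  · obtain ⟨U, hU⟩ := nonempty_basic hb
    have : U ∈ S := Set.mem_iUnion.2 ⟨1, by
      change (1 : M) • b ∈ U.carrier
      rwa [one_smul]⟩
    rw [h] at this
    exact this
  · have : V ∈ S := by
      rw [h]
      trivial
    obtain ⟨m, hm⟩ := Set.mem_iUnion.1 this
    exact hV _ ⟨m, le_rfl⟩ hm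

end Classifying

end GrothendieckPairs

theorem theorem8 {B M : Type u} [BooleanAlgebra B] [Nontrivial B] (J : ZeroDimTopology B)
    [Monoid M] [MulAction M B] [BSet B M] [BJSet J M] [MatchedPair J M] :
    List.TFAE
      [∀ b : B, b ≠ ⊥ → ∃ m : M, m • b = ⊤,
        IsTwoValued (BMShv J M),
        (wedge J M).IsEquivalence,
        IsTopos (BMSet J M),
        (classifyingLocalic J M).IsMinimal] ∧
    ((∀ P ∈ J.parts, P.Finite) →
      ((classifyingLocalic J M).IsMinimal ↔ (classifyingTopological M J).IsMinimal)) := by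
  refine ⟨?_, fun _ =>
    ⟨fun h => classifyingTopological_isMinimal (exists_smul_eq_top_of_localic h),
      fun h => classifyingLocalic_isMinimal (exists_smul_eq_top_of_topological h)⟩⟩
  tfae_have 1 → 2 := isTwoValued
  tfae_have 2 → 1 := fun h b hb => JIdeal.exists_smul_eq_top (J := J)
    (top_mem_of_isTwoValued h (JIdeal.isStable_generated b) hb (JIdeal.self_mem_generated b))
  tfae_have 1 → 3 := wedge_isEquivalence
  tfae_have 3 → 1 := exists_smul_eq_top_of_wedge
  tfae_have 1 → 4 := BMSet.isTopos
  tfae_have 4 → 1 := fun ⟨_, _, ⟨⟨c⟩⟩⟩ => BMSet.exists_smul_eq_top_of_classifier c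
  tfae_have 1 → 5 := classifyingLocalic_isMinimal
  tfae_have 5 → 1 := exists_smul_eq_top_of_localic
  tfae_finish
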